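/- Let the memory and the system be qubits, and let $U$ be a unitary operator on $\mathbb C^2_{\rm mem}\otimes\mathbb C^2_{\rm sys}$. Consider process tomography of repeated uses of one memory device with interaction $U$: in every run a test state $\varrho_x$ is selected independently with probability $q_x>0$ (finitely many $x$, $\sum_x q_x=1$) and sent through the device, and one fixed measurement with effects $E_k$ ($E_k\ge 0$, $\sum_kE_k=I$) is performed on the output. The test states span the operators on the system, so do the effects (informational completeness), and the average test state is $\sum_x q_x\varrho_x=\frac12I$. Let $\mathcal C(\xi)={\rm Tr}_{\rm sys}[U(\xi\otimes\tfrac12I)U^\dagger]$ be the memory channel. Call $U$ a controlled unitary if $U=\sum_l|l\rangle\langle l|\otimes V_l$ with an orthonormal basis $(|l\rangle)$ of the memory and unitary operators $V_l$ on the system. Then $\mathcal C$ is unital, and exactly one of the following holds: (a) $\frac12I$ is the unique state with $\mathcal C(\xi)=\xi$; (b) $U$ is a controlled unitary. Moreover, suppose that $U=(W_2\otimes V_2)\,D(\vec\alpha)\,(W_1\otimes V_1)$, with one-qubit unitaries $W_1,W_2,V_1,V_2$ and $$D(\vec\alpha)=\exp\Big(\tfrac i2\sum_{j=x,y,z}\alpha_j\,\sigma_j\otimes\sigma_j\Big),\qquad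 0\le|\alpha_z|\le\alpha_y\le\alpha_x\le\tfrac{\pi}{2}.$$ In case (b), $\alpha_y=\alpha_z=0$, and there are an orthonormal basis $|+\rangle,|-\rangle$ of the memory and complex numbers $\lambda_\pm$ of modulus $1$ with $U=\lambda_+|+\rangle\langle+|\otimes V_++\lambda_-|-\rangle\langle-|\otimes V_-$, where $V_\pm=V_2\,e^{\pm i\frac{\alpha_x}{2}\sigma_x}V_1$. In case (a), for every initial memory state, almost surely, the average $\frac1n\sum_{j=1}^n\xi_j$ of the memory states $\xi_j$ before the $j$-th run (conditioned on the earlier settings and outcomes) tends to $\overline\xi=\frac12I$ as $n\to\infty$, and tomography reconstructs exactly the channel $\mathcal E(\varrho)={\rm Tr}_{\rm mem}[U(\tfrac12I\otimes\varrho)U^\dagger]$: with $N_x$ the number of uses of $\varrho_x$ and $N_{xk}$ the number of those with outcome $k$ in the first $n$ runs, $\mathcal E$ is the one and only linear map $\Phi$ with $\lim_{n\to\infty}N_{xk}/N_x={\rm Tr}[E_k\Phi(\varrho_x)]$ for all $x,k$. In Bloch form, for all $\vec r\in\mathbb R^3$, $$\mathcal E\big(\tfrac12(I+\vec r\cdot\vec\sigma)\big)=\tfrac12(I+\vec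 r^{\,\prime}\cdot\vec\sigma),\qquad \vec r^{\,\prime}=R_2\,{\rm diag}(c_2c_3,\;c_1c_3,\;c_1c_2)\,R_1\,\vec r,$$ where $c_1=\cos\alpha_x$, $c_2=\cos\alpha_y$, $c_3=\cos\alpha_z$, and $R_1,R_2\in SO(3)$ are the rotations that conjugation by $V_1,V_2$ induces on Bloch vectors: $V_i(\vec r\cdot\vec\sigma)V_i^\dagger=(R_i\vec r)\cdot\vec\sigma$. -/

import Mathlib

open scoped Kronecker ComplexOrder
open Filter Topology MeasureTheory

/-- Operators on one qubit. -/
abbrev Qubit := Matrix (Fin 2) (Fin 2) ℂ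

/-- Operators on (memory qubit) ⊗ (system qubit); the first index is always the memory. -/
abbrev TwoQubit := Matrix (Fin 2 × Fin 2) (Fin 2 × Fin 2) ℂ

namespace MemoryQPT

/-- Density operators of a qubit. -/
def IsState (ρ : Qubit) : Prop := ρ.PosSemidef ∧ ρ.trace = 1

/-- The complete mixture `I / 2`. -/
noncomputable def mixed : Qubit := (1 / 2 : ℂ) • (1 : Qubit)

/-- Partial trace over the system, leaving an operator on the memory. -/
def traceSystem (A : TwoQubit) : Qubit := Matrix.of fun i j => ∑ s, A (i, s) (j, s)

/-- Partial trace over the memory, leaving an operator on the system. -/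
def traceMemory (A : TwoQubit) : Qubit := Matrix.of fun s t => ∑ i, A (i, s) (i, t)

/-- The Pauli matrices `σ_x, σ_y, σ_z`, indexed by `0, 1, 2`. -/
noncomputable def pauli : Fin 3 → Qubit :=
  ![!![0, 1; 1, 0], !![0, -Complex.I; Complex.I, 0], !![1, 0; 0, -1]]

/-- `r · σ` for a real vector `r`. -/
noncomputable def pauliVec (r : Fin 3 → ℝ) : Qubit := ∑ j, (r j : ℂ) • pauli j

/-- The operator `(I + r · σ) / 2` with Bloch vector `r`. -/
noncomputable def bloch (r : Fin 3 → ℝ) : Qubit := (1 / 2 : ℂ) • (1 + pauliVec r)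

/-- `R` is the real matrix that represents conjugation by `V` on Bloch vectors. -/
def IsBlochRotation (V : Qubit) (R : Matrix (Fin 3) (Fin 3) ℝ) : Prop :=
  ∀ r : Fin 3 → ℝ, V * pauliVec r * V.conjTranspose = pauliVec (R.mulVec r)

/-- `D(α) = exp ((i/2) ∑ⱼ αⱼ σⱼ ⊗ σⱼ)`. -/
noncomputable def interaction (α : Fin 3 → ℝ) : TwoQubit :=
  NormedSpace.exp ((Complex.I / 2) • ∑ j, (α j : ℂ) • (pauli j ⊗ₖ pauli j))

/-- `U = (W₂ ⊗ V₂) D(α) (W₁ ⊗ V₁)` with unitary `W₁, W₂` on the memory, unitary `V₁, V₂` on the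
system and `|α_z| ≤ α_y ≤ α_x ≤ π/2`. -/
structure IsCanonicalForm (U : TwoQubit) (α : Fin 3 → ℝ) (W₁ W₂ V₁ V₂ : Qubit) : Prop where
  memory_in : W₁ ∈ Matrix.unitaryGroup (Fin 2) ℂ
  memory_out : W₂ ∈ Matrix.unitaryGroup (Fin 2) ℂ
  system_in : V₁ ∈ Matrix.unitaryGroup (Fin 2) ℂ
  system_out : V₂ ∈ Matrix.unitaryGroup (Fin 2) ℂ
  abs_z_le_y : |α 2| ≤ α 1
  y_le_x : α 1 ≤ α 0
  x_le : α 0 ≤ Real.pi / 2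
  eq : U = (W₂ ⊗ₖ V₂) * interaction α * (W₁ ⊗ₖ V₁)

/-- The rank-one projection `|v⟩⟨v|` (for a unit vector `v`). -/
noncomputable def ketBra (v : EuclideanSpace ℂ (Fin 2)) : Qubit :=
  Matrix.of fun i j => v i * star (v j)

/-- `U = ∑ₗ |l⟩⟨l| ⊗ Vₗ` with an orthonormal basis `|l⟩` of the memory and unitaries `Vₗ` on the
system. -/
def IsControlledUnitary (U : TwoQubit) : Prop :=
  ∃ (b : OrthonormalBasis (Fin 2) ℂ (EuclideanSpace ℂ (Fin 2))) (V : Fin 2 → Qubit),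
    (∀ l, V l ∈ Matrix.unitaryGroup (Fin 2) ℂ) ∧ U = ∑ l, ketBra (b l) ⊗ₖ V l

/-- The map induced on the memory by a system in the state `ρ`: `ξ ↦ Tr_system[U (ξ ⊗ ρ) U†]`. -/
def memoryChannel (U : TwoQubit) (ρ ξ : Qubit) : Qubit :=
  traceSystem (U * (ξ ⊗ₖ ρ) * U.conjTranspose)

/-- The map induced on the system by a memory in the state `ξ`: `ρ ↦ Tr_memory[U (ξ ⊗ ρ) U†]`. -/
def systemChannel (U : TwoQubit) (ξ : Qubit) : Qubit →ₗ[ℂ] Qubit where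
  toFun ρ := traceMemory (U * (ξ ⊗ₖ ρ) * U.conjTranspose)
  map_add' ρ ρ' := by
    ext s t
    simp [traceMemory, Matrix.kronecker_add, Matrix.mul_add, Matrix.add_mul,
      Finset.sum_add_distrib]
  map_smul' c ρ := by
    ext s t
    simp [traceMemory, Matrix.kronecker_smul, mul_add]

/-- `I / 2` is a fixed point of `C`, and the only one among the states. -/
def HasUniqueFixedState (C : Qubit → Qubit) : Prop :=
  C mixed = mixed ∧ ∀ ξ, IsState ξ → C ξ = ξ → ξ = mixed

/-- A process tomography scheme with randomly chosen test states and one fixed measurement: in every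
run the test state `ρ x` is selected with probability `q x`, and the measurement with effects `E k`
is performed. The test states and the effects are complete, so that a linear map `Φ` is determined
by the numbers `Tr[E k Φ(ρ x)]`. -/
structure Scheme (X K : Type*) [Fintype X] [Fintype K] where
  q : X → ℝ
  q_pos : ∀ x, 0 < q x
  q_sum : ∑ x, q x = 1
  ρ : X → Qubit
  ρ_state : ∀ x, IsState (ρ x)
  E : K → Qubit
  E_pos : ∀ k, (E k).PosSemidef
  E_sum : ∑ k, E k = 1
  ρ_complete : Submodule.span ℂ (Set.range ρ) = ⊤
  E_complete : Submodule.span ℂ (Set.range E) = ⊤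

variable {X K : Type*} [Fintype X] [Fintype K]

namespace Scheme

/-- The average test state. -/
noncomputable def average (T : Scheme X K) : Qubit := ∑ x, (T.q x : ℂ) • T.ρ x

/-- The unnormalized memory state after a run with test state `ρ x` and outcome `k`, when `ξ` was the
memory state before it: `Tr_system[U (ξ ⊗ ρ x) U† (I ⊗ E k)]`. -/
def instrument (T : Scheme X K) (U : TwoQubit) (x : X) (k : K) (ξ : Qubit) : Qubit :=
  traceSystem (U * (ξ ⊗ₖ T.ρ x) * U.conjTranspose * ((1 : Qubit) ⊗ₖ T.E k))

/-- The unnormalized memory state after the first `n` runs with settings and outcomes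
`w 0, …, w (n-1)`. Its trace is the probability of these settings and outcomes. -/
noncomputable def branch (T : Scheme X K) (U : TwoQubit) (ξ : Qubit) (w : ℕ → X × K) : ℕ → Qubit
  | 0 => ξ
  | n + 1 => (T.q (w n).1 : ℂ) • T.instrument U (w n).1 (w n).2 (T.branch U ξ w n)

/-- The memory state before run number `n` (counted from `0`), given the earlier record. -/
noncomputable def memoryState (T : Scheme X K) (U : TwoQubit) (ξ : Qubit) (w : ℕ → X × K) (n : ℕ) :
    Qubit :=
  (T.branch U ξ w n).trace⁻¹ • T.branch U ξ w n

/-- The random record `ev j ω` (setting and outcome in run `j`) of repeated uses of one memory device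
with interaction `U` and initial memory state `ξ`. -/
structure IsRecord {Ω : Type*} [MeasurableSpace Ω] (T : Scheme X K) (U : TwoQubit) (ξ : Qubit)
    (μ : Measure Ω) (ev : ℕ → Ω → X × K) : Prop where
  measurable : ∀ j e, MeasurableSet {ω | ev j ω = e}
  law : ∀ (n : ℕ) (w : ℕ → X × K),
    μ {ω | ∀ j < n, ev j ω = w j} = ENNReal.ofReal (T.branch U ξ w n).trace.re

end Scheme

/-- The average memory state over the first `n` runs. -/
noncomputable def meanMemoryState (T : Scheme X K) (U : TwoQubit) (ξ : Qubit) (w : ℕ → X × K)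
    (n : ℕ) : Qubit :=
  (n : ℂ)⁻¹ • ∑ j ∈ Finset.range n, T.memoryState U ξ w j

open Classical in
/-- How often the setting `x` was used in the first `n` runs. -/
noncomputable def settingCount (w : ℕ → X × K) (x : X) (n : ℕ) : ℕ :=
  ((Finset.range n).filter fun j => (w j).1 = x).card

open Classical in
/-- How often the setting `x` was used with outcome `k` in the first `n` runs. -/
noncomputable def eventCount (w : ℕ → X × K) (x : X) (k : K) (n : ℕ) : ℕ :=
  ((Finset.range n).filter fun j => w j = (x, k)).card

/-- Tomography on the record `w` yields `Φ`: the relative frequency of every outcome `k` among the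
runs with setting `x` tends to `Tr[E k Φ(ρ x)]`. -/
def Reconstructs (T : Scheme X K) (w : ℕ → X × K) (Φ : Qubit →ₗ[ℂ] Qubit) : Prop :=
  ∀ x k, Tendsto (fun n => (eventCount w x k n : ℂ) / (settingCount w x n : ℂ)) atTop
    (𝓝 (T.E k * Φ (T.ρ x)).trace)

end MemoryQPT

namespace MemoryQPT

/-! ### Partial traces -/

/-! Let C be the memory channel for system input I/2. If H is Hermitian and C(H) = H, then U(H ⊗
I)U† and H ⊗ I have the same Hilbert–Schmidt norm, and their inner product, computed by tracing out
the system first, equals the square of that norm. Equality in Cauchy–Schwarz makes them coincide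
(`commute_of_fixed`). A fixed state other than I/2 therefore gives a nonscalar H with H ⊗ I
commuting with U; so do its two rank-one spectral projections, and U is block diagonal
(`isControlledUnitary_of_commute`). Conversely, the projections of a controlled unitary are fixed
states.

In canonical form everything follows from D(α)(σⱼ ⊗ I)D(α)† = D(β)(σⱼ ⊗ I), where β arises from 2α
by deleting entry j (`interaction_mul_local`), and from its analogue on the system. Under the
partial traces only the identity component of D(β) survives, and that is a product of two cosines.
This gives the Bloch form of both channels. A fixed Bloch vector must not be shortened, which forces
α_y = α_z = 0; the controlled form is then read off.

For the almost sure statements, the conditional mean of the next memory state is C of the present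
one. The differences ξₘ₊₁ − C(ξₘ) are thus bounded martingale differences, and their averages vanish
almost surely by an L² argument along squares (`HasPrefixLaw.ae_tendsto_average`). Telescoping shows
that the mean memory state is asymptotically fixed by C; since it has trace one and C has a unique
fixed state, it converges to I/2 (`tendsto_mixed`). The same law of large numbers compares event
counts with their conditional probabilities, which are linear in the memory state, so frequencies
converge to the values at I/2. Informational completeness leaves only one linear map with these
limits. -/

theorem traceSystem_add (A B : TwoQubit) : traceSystem (A + B) = traceSystem A + traceSystem B := by
  ext i j; simp [traceSystem, Finset.sum_add_distrib]

theorem traceSystem_smul (c : ℂ) (A : TwoQubit) : traceSystem (c • A) = c • traceSystem A := by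
  ext i j; simp [traceSystem, mul_add]

theorem traceMemory_add (A B : TwoQubit) : traceMemory (A + B) = traceMemory A + traceMemory B := by
  ext i j; simp [traceMemory, Finset.sum_add_distrib]

theorem traceMemory_smul (c : ℂ) (A : TwoQubit) : traceMemory (c • A) = c • traceMemory A := by
  ext i j; simp [traceMemory, mul_add]

theorem traceSystem_kronecker (A B : Qubit) : traceSystem (A ⊗ₖ B) = B.trace • A := by
  ext i j
  simp [traceSystem, Matrix.trace, ← Finset.mul_sum, mul_comm]

theorem traceMemory_kronecker (A B : Qubit) : traceMemory (A ⊗ₖ B) = A.trace • B := by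
  ext i j
  simp [traceMemory, Matrix.trace]
  ring

theorem trace_traceSystem (A : TwoQubit) : (traceSystem A).trace = A.trace := by
  simp [traceSystem, Matrix.trace, Fintype.sum_prod_type]

theorem trace_traceMemory (A : TwoQubit) : (traceMemory A).trace = A.trace := by
  simp [traceMemory, Matrix.trace, Fintype.sum_prod_type]
  ring

theorem traceSystem_memory_mul (A : Qubit) (M : TwoQubit) :
    traceSystem ((A ⊗ₖ (1 : Qubit)) * M) = A * traceSystem M := by
  ext i j
  simp [traceSystem, Matrix.mul_apply, Fintype.sum_prod_type, Matrix.one_apply, mul_add]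
  ring

theorem traceSystem_mul_memory (A : Qubit) (M : TwoQubit) :
    traceSystem (M * (A ⊗ₖ (1 : Qubit))) = traceSystem M * A := by
  ext i j
  simp [traceSystem, Matrix.mul_apply, Fintype.sum_prod_type, Matrix.one_apply, add_mul]
  ring

/-- Partial traces are cyclic only for operators acting on the factor that is traced out; this is
what removes local unitaries there and lets half of an effect be moved to the left. -/
theorem traceSystem_mul_system (B : Qubit) (M : TwoQubit) :
    traceSystem (M * ((1 : Qubit) ⊗ₖ B)) = traceSystem (((1 : Qubit) ⊗ₖ B) * M) := by
  ext i j
  simp [traceSystem, Matrix.mul_apply, Fintype.sum_prod_type, Matrix.one_apply, ite_mul]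
  fin_cases i <;> fin_cases j <;> simp <;> ring

theorem traceMemory_system_mul (B : Qubit) (M : TwoQubit) :
    traceMemory (((1 : Qubit) ⊗ₖ B) * M) = B * traceMemory M := by
  ext i j
  simp [traceMemory, Matrix.mul_apply, Fintype.sum_prod_type, Matrix.one_apply, mul_add]
  ring

theorem traceMemory_mul_system (B : Qubit) (M : TwoQubit) :
    traceMemory (M * ((1 : Qubit) ⊗ₖ B)) = traceMemory M * B := by
  ext i j
  simp [traceMemory, Matrix.mul_apply, Fintype.sum_prod_type, Matrix.one_apply, add_mul]
  ring

theorem traceMemory_mul_memory (A : Qubit) (M : TwoQubit) :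
    traceMemory (M * (A ⊗ₖ (1 : Qubit))) = traceMemory ((A ⊗ₖ (1 : Qubit)) * M) := by
  ext i j
  simp [traceMemory, Matrix.mul_apply, Fintype.sum_prod_type, Matrix.one_apply, ite_mul]
  ring

theorem kronecker_eq_mul (A B : Qubit) :
    A ⊗ₖ B = (A ⊗ₖ (1 : Qubit)) * ((1 : Qubit) ⊗ₖ B) := by
  rw [← Matrix.mul_kronecker_mul]; simp

theorem kronecker_eq_mul' (A B : Qubit) :
    A ⊗ₖ B = ((1 : Qubit) ⊗ₖ B) * (A ⊗ₖ (1 : Qubit)) := by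
  rw [← Matrix.mul_kronecker_mul]; simp

/-- The partial trace over the system of a local conjugation. -/
theorem traceSystem_conj (W V : Qubit) (hV : V ∈ Matrix.unitaryGroup (Fin 2) ℂ) (M : TwoQubit) :
    traceSystem ((W ⊗ₖ V) * M * (W ⊗ₖ V).conjTranspose) =
      W * traceSystem M * W.conjTranspose := by
  have hV' : V.conjTranspose * V = 1 := Matrix.mem_unitaryGroup_iff'.mp hV
  rw [Matrix.conjTranspose_kronecker, kronecker_eq_mul W V, kronecker_eq_mul' W.conjTranspose,
    ← mul_assoc, traceSystem_mul_memory, mul_assoc, mul_assoc, traceSystem_memory_mul,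
    ← mul_assoc, traceSystem_mul_system, ← mul_assoc, ← Matrix.mul_kronecker_mul, hV']
  simp

theorem traceMemory_conj (W V : Qubit) (hW : W ∈ Matrix.unitaryGroup (Fin 2) ℂ) (M : TwoQubit) :
    traceMemory ((W ⊗ₖ V) * M * (W ⊗ₖ V).conjTranspose) =
      V * traceMemory M * V.conjTranspose := by
  have hW' : W.conjTranspose * W = 1 := Matrix.mem_unitaryGroup_iff'.mp hW
  rw [Matrix.conjTranspose_kronecker, kronecker_eq_mul' W V, kronecker_eq_mul W.conjTranspose,
    ← mul_assoc, traceMemory_mul_system, mul_assoc, mul_assoc, traceMemory_system_mul,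
    ← mul_assoc, traceMemory_mul_memory, ← mul_assoc, ← Matrix.mul_kronecker_mul, hW']
  simp

theorem traceSystem_conjTranspose (A : TwoQubit) :
    traceSystem A.conjTranspose = (traceSystem A).conjTranspose := by
  ext i j; simp [traceSystem]

theorem posSemidef_traceSystem {A : TwoQubit} (hA : A.PosSemidef) : (traceSystem A).PosSemidef := by
  have : traceSystem A = ∑ s, A.submatrix (fun i => (i, s)) (fun i => (i, s)) := by
    ext i j; simp [traceSystem]
  rw [this]
  exact Matrix.posSemidef_sum _ fun s _ => hA.submatrix _

theorem exists_eq_conjTranspose_mul {E : Qubit} (hE : E.PosSemidef) :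
    ∃ F : Qubit, E = F.conjTranspose * F := by
  open scoped MatrixOrder Matrix.Norms.L2Operator in
  exact CStarAlgebra.nonneg_iff_eq_star_mul_self.mp hE.nonneg

/-- Tracing out the system against an effect preserves positivity. -/
theorem posSemidef_traceSystem_mul {A : TwoQubit} (hA : A.PosSemidef) {E : Qubit}
    (hE : E.PosSemidef) : (traceSystem (A * ((1 : Qubit) ⊗ₖ E))).PosSemidef := by
  obtain ⟨F, rfl⟩ := exists_eq_conjTranspose_mul hE
  have h : (1 : Qubit) ⊗ₖ (F.conjTranspose * F) =
      ((1 : Qubit) ⊗ₖ F).conjTranspose * ((1 : Qubit) ⊗ₖ F) := by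
    rw [Matrix.conjTranspose_kronecker, ← Matrix.mul_kronecker_mul]; simp
  rw [h, ← mul_assoc, traceSystem_mul_system, ← mul_assoc]
  exact posSemidef_traceSystem (hA.mul_mul_conjTranspose_same _)

/-! ### The memory channel -/

theorem memoryChannel_add (U : TwoQubit) (ρ A B : Qubit) :
    memoryChannel U ρ (A + B) = memoryChannel U ρ A + memoryChannel U ρ B := by
  simp [memoryChannel, Matrix.add_kronecker, Matrix.mul_add, Matrix.add_mul, traceSystem_add]

theorem memoryChannel_smul (U : TwoQubit) (ρ : Qubit) (c : ℂ) (A : Qubit) :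
    memoryChannel U ρ (c • A) = c • memoryChannel U ρ A := by
  simp [memoryChannel, Matrix.smul_kronecker, traceSystem_smul]

/-- The memory channel as a linear map. -/
def memoryMap (U : TwoQubit) (ρ : Qubit) : Qubit →ₗ[ℂ] Qubit where
  toFun := memoryChannel U ρ
  map_add' := memoryChannel_add U ρ
  map_smul' := memoryChannel_smul U ρ

theorem memoryMap_apply (U : TwoQubit) (ρ A : Qubit) : memoryMap U ρ A = memoryChannel U ρ A := rfl

theorem memoryChannel_mixed (U : TwoQubit) (A : Qubit) :
    memoryChannel U mixed A =
      (1 / 2 : ℂ) • traceSystem (U * (A ⊗ₖ (1 : Qubit)) * U.conjTranspose) := by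
  simp [memoryChannel, mixed, Matrix.kronecker_smul, traceSystem_smul]

theorem memoryChannel_mixed_one {U : TwoQubit} (hU : U ∈ Matrix.unitaryGroup (Fin 2 × Fin 2) ℂ) :
    memoryChannel U mixed 1 = 1 := by
  have h : U * U.conjTranspose = 1 := Matrix.mem_unitaryGroup_iff.mp hU
  rw [memoryChannel_mixed, Matrix.one_kronecker_one, mul_one, h, ← Matrix.one_kronecker_one,
    traceSystem_kronecker]
  simp [Matrix.trace_one]

theorem memoryChannel_mixed_mixed {U : TwoQubit}
    (hU : U ∈ Matrix.unitaryGroup (Fin 2 × Fin 2) ℂ) : memoryChannel U mixed mixed = mixed := by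
  conv_lhs => rw [show memoryChannel U mixed mixed = _ from memoryChannel_smul U mixed _ 1,
    memoryChannel_mixed_one hU]
  rfl

theorem memoryChannel_conjTranspose (U : TwoQubit) (A : Qubit) :
    memoryChannel U mixed A.conjTranspose = (memoryChannel U mixed A).conjTranspose := by
  rw [memoryChannel_mixed, memoryChannel_mixed, Matrix.conjTranspose_smul,
    ← traceSystem_conjTranspose]
  simp [Matrix.conjTranspose_kronecker, mul_assoc]

/-- An operator commuting with `U` after tensoring with `I` is fixed by the memory channel. -/
theorem memoryChannel_eq_of_commute {U : TwoQubit}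
    (hU : U ∈ Matrix.unitaryGroup (Fin 2 × Fin 2) ℂ) {A : Qubit}
    (h : U * (A ⊗ₖ (1 : Qubit)) = (A ⊗ₖ (1 : Qubit)) * U) : memoryChannel U mixed A = A := by
  have hU' : U * U.conjTranspose = 1 := Matrix.mem_unitaryGroup_iff.mp hU
  rw [memoryChannel_mixed, h, mul_assoc, hU', mul_one, traceSystem_kronecker]
  simp [Matrix.trace_one]

/-- A Hermitian fixed point of the memory channel commutes with the interaction. -/
theorem commute_of_fixed {U : TwoQubit} (hU : U ∈ Matrix.unitaryGroup (Fin 2 × Fin 2) ℂ)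
    {H : Qubit} (hH : H.IsHermitian) (hfix : memoryChannel U mixed H = H) :
    U * (H ⊗ₖ (1 : Qubit)) = (H ⊗ₖ (1 : Qubit)) * U := by
  have hU' : U.conjTranspose * U = 1 := Matrix.mem_unitaryGroup_iff'.mp hU
  have hT : traceSystem (U * (H ⊗ₖ (1 : Qubit)) * U.conjTranspose) = (2 : ℂ) • H := by
    rw [memoryChannel_mixed] at hfix
    conv_rhs => rw [← hfix]
    rw [smul_smul]; norm_num
  set G : TwoQubit := H ⊗ₖ (1 : Qubit) with hG
  have hGH : G.conjTranspose = G := by rw [hG, Matrix.conjTranspose_kronecker, hH.eq]; simp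
  set A := U * G * U.conjTranspose with hA
  have hAH : A.conjTranspose = A := by simp [hA, hGH, mul_assoc]
  have hGG : G * G = (H * H) ⊗ₖ (1 : Qubit) := by rw [hG, ← Matrix.mul_kronecker_mul]; simp
  -- The two traces give ‖A‖² = ‖G‖² and ⟨A, G⟩ = ‖G‖² in the Hilbert–Schmidt inner product, hence
  -- ‖A − G‖² = 0. Only the inner product uses that H is fixed.
  have h1 : (A * A).trace = (G * G).trace := by
    have : A * A = U * (G * G) * U.conjTranspose := by
      rw [hA]
      calc _ = U * G * (U.conjTranspose * U) * G * U.conjTranspose := by simp only [mul_assoc]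
        _ = _ := by rw [hU']; simp only [mul_assoc, one_mul]
    rw [this, Matrix.trace_mul_cycle, hU', one_mul]
  have h2 : (A * G).trace = (G * G).trace := by
    rw [← trace_traceSystem, traceSystem_mul_memory, hT, hGG, Matrix.trace_kronecker]
    simp [Matrix.trace_one, mul_comm]
  have h3 : A - G = 0 := by
    rw [← Matrix.trace_conjTranspose_mul_self_eq_zero_iff, Matrix.conjTranspose_sub, hAH, hGH,
      sub_mul, mul_sub, mul_sub, Matrix.trace_sub, Matrix.trace_sub, Matrix.trace_sub,
      Matrix.trace_mul_comm G A, h1, h2]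
    ring
  calc U * G = A * U := by rw [hA, mul_assoc _ _ U, hU', mul_one]
    _ = G * U := by rw [sub_eq_zero.mp h3]

/-! ### Rank-one projections -/

abbrev Ket := EuclideanSpace ℂ (Fin 2)

theorem isHermitian_ketBra (v : Ket) : (ketBra v).IsHermitian := by
  ext i j
  simp [ketBra, mul_comm]

theorem sum_star_mul_self (b : OrthonormalBasis (Fin 2) ℂ Ket) (i j : Fin 2) :
    ∑ k, star (b i k) * b j k = if i = j then 1 else 0 := by
  have := orthonormal_iff_ite.mp b.orthonormal i j
  rw [← this]
  simp [PiLp.inner_apply, mul_comm]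

theorem ketBra_mul_ketBra (b : OrthonormalBasis (Fin 2) ℂ Ket) (i j : Fin 2) :
    ketBra (b i) * ketBra (b j) = if i = j then ketBra (b i) else 0 := by
  have h := sum_star_mul_self b i j
  ext s t
  have : (ketBra (b i) * ketBra (b j)) s t =
      b i s * (∑ k, star (b i k) * b j k) * star (b j t) := by
    simp only [ketBra, Matrix.mul_apply, Matrix.of_apply, Finset.mul_sum, Finset.sum_mul]
    exact Finset.sum_congr rfl fun k _ => by ring
  rw [this, h]
  split_ifs with hij
  · subst hij; simp [ketBra]
  · simp

theorem sum_ketBra (b : OrthonormalBasis (Fin 2) ℂ Ket) : ∑ l, ketBra (b l) = 1 := by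
  set M : Qubit := Matrix.of fun i l => b l i with hM
  have h : M.conjTranspose * M = 1 := by
    ext i j
    rw [Matrix.mul_apply, Matrix.one_apply, ← sum_star_mul_self b i j]
    rfl
  rw [← mul_eq_one_comm.mp h]
  ext i j
  simp [hM, ketBra, Matrix.mul_apply]

theorem trace_ketBra (b : OrthonormalBasis (Fin 2) ℂ Ket) (l : Fin 2) :
    (ketBra (b l)).trace = 1 := by
  have h := sum_star_mul_self b l l
  simp only [if_true] at h
  rw [← h]
  simp [Matrix.trace, ketBra, mul_comm]

theorem ketBra_mul_self (b : OrthonormalBasis (Fin 2) ℂ Ket) (l : Fin 2) :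
    ketBra (b l) * ketBra (b l) = ketBra (b l) := by
  simp [ketBra_mul_ketBra]

theorem isState_ketBra (b : OrthonormalBasis (Fin 2) ℂ Ket) (l : Fin 2) :
    IsState (ketBra (b l)) := by
  refine ⟨?_, trace_ketBra b l⟩
  have := Matrix.posSemidef_conjTranspose_mul_self (ketBra (b l))
  rwa [(isHermitian_ketBra _).eq, ketBra_mul_self] at this

theorem exists_spectral {A : Qubit} (hA : A.IsHermitian) :
    ∃ (b : OrthonormalBasis (Fin 2) ℂ Ket) (c : Fin 2 → ℝ), A = ∑ l, (c l : ℂ) • ketBra (b l) := by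
  refine ⟨hA.eigenvectorBasis, hA.eigenvalues, ?_⟩
  conv_lhs => rw [hA.spectral_theorem]
  ext i j
  simp [Unitary.conjStarAlgAut_apply, Matrix.mul_apply, Matrix.diagonal_apply, ketBra,
    Matrix.IsHermitian.eigenvectorUnitary_apply, Matrix.star_apply]
  ring

/-- Compressing the memory to one ray leaves freedom on the system only; this identifies the blocks
of a block diagonal operator as partial traces. -/
theorem ketBra_kronecker_conj (v : Ket) (M : TwoQubit) :
    (ketBra v ⊗ₖ (1 : Qubit)) * M * (ketBra v ⊗ₖ (1 : Qubit)) =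
      ketBra v ⊗ₖ traceMemory (M * (ketBra v ⊗ₖ (1 : Qubit))) := by
  ext ⟨i, s⟩ ⟨j, t⟩
  fin_cases s <;> fin_cases t <;>
  simp [traceMemory, ketBra, Matrix.mul_apply, Fintype.sum_prod_type, Matrix.one_apply] <;> ring

theorem ketBra_conj (v : Ket) (M : Qubit) :
    ketBra v * M * ketBra v = (M * ketBra v).trace • ketBra v := by
  ext i j
  simp [Matrix.trace, ketBra, Matrix.mul_apply]
  ring

/-- A unitary that commutes with a rank-one projection multiplies it by a phase. -/
theorem exists_phase {G : Qubit} (hG : G ∈ Matrix.unitaryGroup (Fin 2) ℂ)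
    (b : OrthonormalBasis (Fin 2) ℂ Ket) (l : Fin 2)
    (h : G * ketBra (b l) = ketBra (b l) * G) :
    ∃ c : ℂ, ‖c‖ = 1 ∧ G * ketBra (b l) = c • ketBra (b l) := by
  have hc : G * ketBra (b l) = (G * ketBra (b l)).trace • ketBra (b l) := by
    rw [← ketBra_conj, ← h, mul_assoc, ketBra_mul_self]
  set c := (G * ketBra (b l)).trace
  refine ⟨c, ?_, hc⟩
  have hG' : G.conjTranspose * G = 1 := Matrix.mem_unitaryGroup_iff'.mp hG
  have h1 : (G * ketBra (b l)).conjTranspose * (G * ketBra (b l)) = ketBra (b l) := by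
    rw [Matrix.conjTranspose_mul, (isHermitian_ketBra _).eq, mul_assoc,
      ← mul_assoc G.conjTranspose, hG', one_mul, ketBra_mul_self]
  rw [hc, Matrix.conjTranspose_smul, (isHermitian_ketBra _).eq, smul_mul_smul_comm,
    ketBra_mul_self] at h1
  have h2 := congrArg Matrix.trace h1
  rw [Matrix.trace_smul, trace_ketBra, smul_eq_mul, mul_one] at h2
  have h3 : (‖c‖ ^ 2 : ℝ) = 1 := by
    have := Complex.conj_mul' c
    rw [← Complex.ofReal_inj]; push_cast; rw [← this]; exact h2
  nlinarith [norm_nonneg c]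

/-- The spectral projections of a nonscalar Hermitian operator commute with what it commutes
with. -/
theorem exists_basis_commute {H : Qubit} (hH : H.IsHermitian) (hs : ∀ c : ℂ, H ≠ c • 1) :
    ∃ b : OrthonormalBasis (Fin 2) ℂ Ket, ∀ l, ∃ x y : ℂ, ketBra (b l) = x • H + y • 1 := by
  obtain ⟨b, c, hb⟩ := exists_spectral hH
  refine ⟨b, ?_⟩
  have hsum := sum_ketBra b
  rw [Fin.sum_univ_two] at hb hsum
  have hne : (c 0 : ℂ) - c 1 ≠ 0 := by
    intro h
    apply hs (c 1)
    rw [hb, sub_eq_zero.mp h, ← smul_add, hsum]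
  -- Lagrange interpolation at the two eigenvalues, which differ because H is not scalar.
  have h0 : ketBra (b 0) = ((c 0 : ℂ) - c 1)⁻¹ • H + (-((c 0 : ℂ) - c 1)⁻¹ * c 1) • 1 := by
    calc ketBra (b 0) = (((c 0 : ℂ) - c 1)⁻¹ * ((c 0 : ℂ) - c 1)) • ketBra (b 0) := by
          rw [inv_mul_cancel₀ hne, one_smul]
      _ = _ := by rw [hb, ← hsum]; module
  intro l
  fin_cases l
  · exact ⟨_, _, h0⟩
  · refine ⟨-((c 0 : ℂ) - c 1)⁻¹, 1 + ((c 0 : ℂ) - c 1)⁻¹ * c 1, ?_⟩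
    change ketBra (b 1) = _
    rw [eq_sub_of_add_eq' hsum, h0]
    module

/-! ### The dichotomy -/

theorem not_hasUniqueFixedState_of_isControlledUnitary {U : TwoQubit}
    (hU : U ∈ Matrix.unitaryGroup (Fin 2 × Fin 2) ℂ) (h : IsControlledUnitary U) :
    ¬ HasUniqueFixedState (memoryChannel U mixed) := by
  rintro ⟨-, huniq⟩
  obtain ⟨b, V, -, rfl⟩ := h
  have hcomm : (∑ l, ketBra (b l) ⊗ₖ V l) * (ketBra (b 0) ⊗ₖ (1 : Qubit)) =
      (ketBra (b 0) ⊗ₖ (1 : Qubit)) * ∑ l, ketBra (b l) ⊗ₖ V l := by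
    simp [Fin.sum_univ_two, add_mul, mul_add, ← Matrix.mul_kronecker_mul, ketBra_mul_ketBra]
  have hP := huniq _ (isState_ketBra b 0) (memoryChannel_eq_of_commute hU hcomm)
  -- The control projection is a fixed state; it is idempotent, whereas I/2 is not.
  have h2 := ketBra_mul_self b 0
  rw [hP] at h2
  have := congrFun (congrFun h2 0) 0
  simp [mixed] at this

/-- A memory channel with several fixed states has a nonscalar Hermitian fixed point. -/
theorem exists_fixed_of_not_unique {U : TwoQubit}
    (hU : U ∈ Matrix.unitaryGroup (Fin 2 × Fin 2) ℂ)
    (h : ¬ HasUniqueFixedState (memoryChannel U mixed)) :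
    ∃ H : Qubit, H.IsHermitian ∧ (∀ c : ℂ, H ≠ c • 1) ∧ memoryChannel U mixed H = H := by
  rw [HasUniqueFixedState, and_iff_right (memoryChannel_mixed_mixed hU)] at h
  push Not at h
  obtain ⟨ξ, hξ, hfix, hne⟩ := h
  refine ⟨ξ, hξ.1.1, ?_, hfix⟩
  rintro c rfl
  apply hne
  have := hξ.2
  rw [Matrix.trace_smul, Matrix.trace_one] at this
  simp only [Fintype.card_fin, smul_eq_mul] at this
  push_cast at this
  rw [mixed, eq_div_of_mul_eq two_ne_zero this]

/-- Commuting with the projections of a basis makes U block diagonal along the memory. Each block is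
extracted by a partial trace, and it is unitary because U†U = 1 restricts to the block. -/
theorem isControlledUnitary_of_commute {U : TwoQubit}
    (hU : U ∈ Matrix.unitaryGroup (Fin 2 × Fin 2) ℂ) (b : OrthonormalBasis (Fin 2) ℂ Ket)
    (h : ∀ l, U * (ketBra (b l) ⊗ₖ (1 : Qubit)) = (ketBra (b l) ⊗ₖ (1 : Qubit)) * U) :
    IsControlledUnitary U := by
  have hU' : U.conjTranspose * U = 1 := Matrix.mem_unitaryGroup_iff'.mp hU
  have hPP : ∀ l, (ketBra (b l) ⊗ₖ (1 : Qubit)) * (ketBra (b l) ⊗ₖ (1 : Qubit)) =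
      ketBra (b l) ⊗ₖ (1 : Qubit) := fun l => by
    rw [← Matrix.mul_kronecker_mul, ketBra_mul_self, mul_one]
  have hV : ∀ l, U * (ketBra (b l) ⊗ₖ (1 : Qubit)) =
      ketBra (b l) ⊗ₖ traceMemory (U * (ketBra (b l) ⊗ₖ (1 : Qubit))) := fun l => by
    rw [← ketBra_kronecker_conj, ← h, mul_assoc, hPP]
  refine ⟨b, fun l => traceMemory (U * (ketBra (b l) ⊗ₖ (1 : Qubit))), fun l => ?_, ?_⟩
  · rw [Matrix.mem_unitaryGroup_iff']
    set V := traceMemory (U * (ketBra (b l) ⊗ₖ (1 : Qubit)))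
    have h1 : (ketBra (b l) ⊗ₖ V).conjTranspose * (ketBra (b l) ⊗ₖ V) =
        ketBra (b l) ⊗ₖ (1 : Qubit) := by
      rw [← hV, Matrix.conjTranspose_mul, Matrix.conjTranspose_kronecker,
        (isHermitian_ketBra _).eq, mul_assoc, ← mul_assoc U.conjTranspose, hU', one_mul,
        Matrix.conjTranspose_one, hPP]
    rw [Matrix.conjTranspose_kronecker, (isHermitian_ketBra _).eq, ← Matrix.mul_kronecker_mul,
      ketBra_mul_self] at h1
    have := congrArg traceMemory h1
    rwa [traceMemory_kronecker, traceMemory_kronecker, trace_ketBra, one_smul, one_smul] at this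
  · simp_rw [← hV]
    rw [← Matrix.mul_sum]
    have : ∑ l, ketBra (b l) ⊗ₖ (1 : Qubit) = 1 := by
      rw [Fin.sum_univ_two, ← Matrix.add_kronecker, ← Fin.sum_univ_two fun l => ketBra (b l),
        sum_ketBra, Matrix.one_kronecker_one]
    rw [this, mul_one]

theorem isControlledUnitary_of_not_unique {U : TwoQubit}
    (hU : U ∈ Matrix.unitaryGroup (Fin 2 × Fin 2) ℂ)
    (h : ¬ HasUniqueFixedState (memoryChannel U mixed)) : IsControlledUnitary U := by
  obtain ⟨H, hH, hs, hfix⟩ := exists_fixed_of_not_unique hU h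
  obtain ⟨b, hb⟩ := exists_basis_commute hH hs
  refine isControlledUnitary_of_commute hU b fun l => ?_
  obtain ⟨x, y, hl⟩ := hb l
  rw [hl, Matrix.add_kronecker, Matrix.smul_kronecker, Matrix.smul_kronecker,
    Matrix.one_kronecker_one, mul_add, add_mul, mul_smul_comm, smul_mul_assoc,
    commute_of_fixed hU hH hfix]
  simp

/-! ### The canonical interaction -/

/-- An involution has spectrum in {1, −1}, so its functional calculus is an algebra homomorphism
from ℂ × ℂ taking (1, −1) to S. Being continuous, it commutes with exp, which is computed
componentwise at (z, −z). -/
theorem exp_smul_of_mul_self_eq_one {n : Type*} [Fintype n] [DecidableEq n]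
    {S : Matrix n n ℂ} (hS : S * S = 1) (z : ℂ) :
    NormedSpace.exp (z • S) = Complex.cosh z • (1 : Matrix n n ℂ) + Complex.sinh z • S := by
  open scoped Matrix.Norms.Operator in
  let f : ℂ × ℂ →ₐ[ℂ] Matrix n n ℂ :=
    { toFun := fun p => ((p.1 + p.2) / 2) • (1 : Matrix n n ℂ) + ((p.1 - p.2) / 2) • S
      map_one' := by simp
      map_mul' := fun p q => by
        simp only [add_mul, mul_add, smul_mul_smul_comm, hS, one_mul, mul_one, Prod.fst_mul,
          Prod.snd_mul]
        module
      map_zero' := by simp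
      map_add' := fun p q => by simp only [Prod.fst_add, Prod.snd_add]; module
      commutes' := fun r => by simp [Algebra.algebraMap_eq_smul_one] }
  have hf : Continuous f := by
    change Continuous fun p : ℂ × ℂ =>
      ((p.1 + p.2) / 2) • (1 : Matrix n n ℂ) + ((p.1 - p.2) / 2) • S
    fun_prop
  have h := NormedSpace.map_exp f hf (z, -z)
  have h1 : f (z, -z) = z • S := by
    change ((z + -z) / 2) • (1 : Matrix n n ℂ) + ((z - -z) / 2) • S = _
    module
  have h2 : NormedSpace.exp ((z, -z) : ℂ × ℂ) = (Complex.exp z, Complex.exp (-z)) := by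
    ext <;> simp [Prod.fst_exp, Prod.snd_exp, Complex.exp_eq_exp_ℂ]
  rw [h1, h2] at h
  exact h.symm

theorem trace_pauli (j : Fin 3) : (pauli j).trace = 0 := by
  fin_cases j <;> simp [pauli, Matrix.trace]

theorem isHermitian_pauli (j : Fin 3) : (pauli j).conjTranspose = pauli j := by
  fin_cases j <;> ext a b <;> fin_cases a <;> fin_cases b <;> simp [pauli]

theorem pauli_mul_self (j : Fin 3) : pauli j * pauli j = 1 := by
  fin_cases j <;> ext a b <;> fin_cases a <;> fin_cases b <;>
    simp [pauli, Matrix.mul_apply]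

/-- Conjugation of one Pauli matrix by another. -/
theorem pauli_conj (j k : Fin 3) :
    pauli j * pauli k * pauli j = (if k = j then (1 : ℂ) else -1) • pauli k := by
  fin_cases j <;> fin_cases k <;> ext a b <;> fin_cases a <;> fin_cases b <;>
    simp [pauli, Matrix.mul_apply]

/-- `σⱼ ⊗ σⱼ`. -/
noncomputable def pauliPair (j : Fin 3) : TwoQubit := pauli j ⊗ₖ pauli j

theorem pauliPair_mul_self (j : Fin 3) : pauliPair j * pauliPair j = 1 := by
  rw [pauliPair, ← Matrix.mul_kronecker_mul, pauli_mul_self, Matrix.one_kronecker_one]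

theorem pauli_mul_pauli :
    pauli 0 * pauli 1 = Complex.I • pauli 2 ∧ pauli 1 * pauli 0 = -Complex.I • pauli 2 ∧
    pauli 1 * pauli 2 = Complex.I • pauli 0 ∧ pauli 2 * pauli 1 = -Complex.I • pauli 0 ∧
    pauli 0 * pauli 2 = -Complex.I • pauli 1 ∧ pauli 2 * pauli 0 = Complex.I • pauli 1 := by
  refine ⟨?_, ?_, ?_, ?_, ?_, ?_⟩ <;> ext a b <;> fin_cases a <;> fin_cases b <;>
    simp [pauli, Matrix.mul_apply]

/-- The factors ±i of the single-qubit products are squared to −1 in either order. Hence the pairs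
commute although the Pauli matrices do not, and the product of all three pairs is −1. -/
theorem pauliPair_mul_pauliPair :
    pauliPair 0 * pauliPair 1 = -pauliPair 2 ∧ pauliPair 1 * pauliPair 0 = -pauliPair 2 ∧
    pauliPair 1 * pauliPair 2 = -pauliPair 0 ∧ pauliPair 2 * pauliPair 1 = -pauliPair 0 ∧
    pauliPair 0 * pauliPair 2 = -pauliPair 1 ∧ pauliPair 2 * pauliPair 0 = -pauliPair 1 := by
  obtain ⟨h1, h2, h3, h4, h5, h6⟩ := pauli_mul_pauli
  refine ⟨?_, ?_, ?_, ?_, ?_, ?_⟩ <;>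
    simp only [pauliPair, ← Matrix.mul_kronecker_mul, h1, h2, h3, h4, h5, h6,
      Matrix.smul_kronecker, Matrix.kronecker_smul, smul_smul] <;> simp

theorem commute_pauliPair (j k : Fin 3) : Commute (pauliPair j) (pauliPair k) := by
  obtain ⟨h1, h2, h3, h4, h5, h6⟩ := pauliPair_mul_pauliPair
  fin_cases j <;> fin_cases k <;> simp [Commute, SemiconjBy, *]

/-- The exponent of the canonical interaction. -/
noncomputable def generator (α : Fin 3 → ℝ) : TwoQubit :=
  (Complex.I / 2) • ∑ j, (α j : ℂ) • pauliPair j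

theorem interaction_eq_exp (α : Fin 3 → ℝ) : interaction α = NormedSpace.exp (generator α) := rfl

theorem commute_generator (a b : Fin 3 → ℝ) : Commute (generator a) (generator b) := by
  refine Commute.smul_left (Commute.smul_right ?_ _) _
  exact Commute.sum_left _ _ _ fun j _ => Commute.sum_right _ _ _ fun k _ =>
    ((commute_pauliPair j k).smul_left _).smul_right _

theorem interaction_mul (a b : Fin 3 → ℝ) :
    interaction a * interaction b = interaction (a + b) := by
  rw [interaction_eq_exp, interaction_eq_exp, interaction_eq_exp,
    ← Matrix.exp_add_of_commute _ _ (commute_generator a b)]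
  congr 1
  simp [generator, add_smul, Finset.sum_add_distrib]

theorem conjTranspose_interaction (a : Fin 3 → ℝ) :
    (interaction a).conjTranspose = interaction (-a) := by
  rw [interaction_eq_exp, interaction_eq_exp, ← Matrix.exp_conjTranspose]
  congr 1
  simp [generator, Matrix.conjTranspose_sum, pauliPair, Matrix.conjTranspose_kronecker,
    isHermitian_pauli, neg_div]

theorem interaction_eq_prod (α : Fin 3 → ℝ) :
    interaction α =
      (Complex.cosh (Complex.I / 2 * α 0) • 1 + Complex.sinh (Complex.I / 2 * α 0) • pauliPair 0) *
      (Complex.cosh (Complex.I / 2 * α 1) • 1 + Complex.sinh (Complex.I / 2 * α 1) • pauliPair 1) *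
      (Complex.cosh (Complex.I / 2 * α 2) • 1 +
        Complex.sinh (Complex.I / 2 * α 2) • pauliPair 2) := by
  have hc : ∀ (j k : Fin 3) (x y : ℂ), Commute (x • pauliPair j) (y • pauliPair k) :=
    fun j k x y => ((commute_pauliPair j k).smul_left _).smul_right _
  rw [← exp_smul_of_mul_self_eq_one (pauliPair_mul_self 0),
    ← exp_smul_of_mul_self_eq_one (pauliPair_mul_self 1),
    ← exp_smul_of_mul_self_eq_one (pauliPair_mul_self 2),
    ← Matrix.exp_add_of_commute _ _ (hc _ _ _ _),
    ← Matrix.exp_add_of_commute _ _ ((hc _ _ _ _).add_left (hc _ _ _ _)), interaction_eq_exp]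
  simp only [generator, Fin.sum_univ_three, smul_add, smul_smul]

theorem cosh_half (a : ℝ) : Complex.cosh (Complex.I / 2 * a) = (Real.cos (a / 2) : ℂ) := by
  rw [show Complex.I / 2 * a = (a / 2 : ℂ) * Complex.I by ring, Complex.cosh_mul_I]
  push_cast; rfl

/-- The expansion of the canonical interaction in products of Pauli matrices. -/
theorem exists_interaction_eq (α : Fin 3 → ℝ) : ∃ u : Fin 3 → ℂ,
    interaction α = ((∏ k, (Real.cos (α k / 2) : ℂ)) -
      ∏ k, Complex.sinh (Complex.I / 2 * α k)) • 1 + ∑ k, u k • pauliPair k := by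
  obtain ⟨h1, h2, h3, h4, h5, h6⟩ := pauliPair_mul_pauliPair
  rw [interaction_eq_prod]
  simp only [← cosh_half, Fin.prod_univ_three]
  set x0 := Complex.cosh (Complex.I / 2 * α 0)
  set x1 := Complex.cosh (Complex.I / 2 * α 1)
  set x2 := Complex.cosh (Complex.I / 2 * α 2)
  set y0 := Complex.sinh (Complex.I / 2 * α 0)
  set y1 := Complex.sinh (Complex.I / 2 * α 1)
  set y2 := Complex.sinh (Complex.I / 2 * α 2)
  -- Each coefficient joins the term containing one pair with the term in which the other two
  -- multiply to its negative. The product of all three pairs feeds the identity coefficient.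
  refine ⟨![y0 * x1 * x2 - x0 * y1 * y2, x0 * y1 * x2 - y0 * x1 * y2,
    x0 * x1 * y2 - y0 * y1 * x2], ?_⟩
  simp only [add_mul, mul_add, smul_mul_smul_comm, mul_one, one_mul, h1, h3, h5, neg_mul,
    pauliPair_mul_self, Fin.sum_univ_three, smul_neg]
  simp only [Matrix.cons_val]
  module

/-- Conjugating by a local Pauli operator flips the sign of two of the three parameters. -/
theorem interaction_mul_local {P : TwoQubit} (hP : P * P = 1) (j : Fin 3)
    (hconj : ∀ k, P * pauliPair k * P = (if k = j then (1 : ℂ) else -1) • pauliPair k)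
    (α : Fin 3 → ℝ) :
    interaction α * P * (interaction α).conjTranspose =
      interaction (fun k => if k = j then 0 else 2 * α k) * P := by
  have hinv : P⁻¹ = P := Matrix.inv_eq_left_inv hP
  have hPu : IsUnit P := IsUnit.of_mul_eq_one P hP
  have h := Matrix.exp_conj P (generator (-α)) hPu
  rw [hinv, ← interaction_eq_exp, ← conjTranspose_interaction] at h
  have hg : P * generator (-α) * P = generator (fun k => if k = j then -α k else α k) := by
    simp only [generator, mul_smul_comm, smul_mul_assoc, Finset.mul_sum, Finset.sum_mul, hconj,
      smul_smul]
    congr 1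
    refine Finset.sum_congr rfl fun k _ => ?_
    split_ifs <;> simp
  have h2 : P * (interaction α).conjTranspose =
      interaction (fun k => if k = j then -α k else α k) * P := by
    rw [interaction_eq_exp (fun k => if k = j then -α k else α k), ← hg, h, mul_assoc, hP, mul_one]
  -- The parameters of the two commuting factors add: entry j cancels and the other two double.
  rw [mul_assoc, h2, ← mul_assoc, interaction_mul]
  congr 2
  funext k
  simp only [Pi.add_apply]
  split_ifs <;> ring

/-- The factors by which the channels of the canonical interaction shrink the Bloch vector. -/
noncomputable def shrink (α : Fin 3 → ℝ) : Fin 3 → ℝ :=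
  ![Real.cos (α 1) * Real.cos (α 2), Real.cos (α 0) * Real.cos (α 2),
    Real.cos (α 0) * Real.cos (α 1)]

/-- The zero entry kills the product of the three sinh factors, and the halves in the cosines undo
the doubling, so the identity coefficient is a product of two cosines. -/
theorem exists_interaction_off (α : Fin 3 → ℝ) (j : Fin 3) : ∃ u : Fin 3 → ℂ,
    interaction (fun k => if k = j then 0 else 2 * α k) =
      (shrink α j : ℂ) • 1 + ∑ k, u k • pauliPair k := by
  obtain ⟨u, hu⟩ := exists_interaction_eq (fun k => if k = j then 0 else 2 * α k)
  refine ⟨u, ?_⟩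
  rw [hu]
  congr 2
  fin_cases j <;> simp [Fin.prod_univ_three, shrink]

/-- After the local Pauli operator is moved to the right, every term σₖ ⊗ σₖ is annihilated by the
partial trace, and only the identity coefficient is left. -/
theorem traceSystem_interaction_pauli (α : Fin 3 → ℝ) (j : Fin 3) :
    traceSystem (interaction α * (pauli j ⊗ₖ (1 : Qubit)) * (interaction α).conjTranspose) =
      (2 * shrink α j : ℂ) • pauli j := by
  have hP : (pauli j ⊗ₖ (1 : Qubit)) * (pauli j ⊗ₖ (1 : Qubit)) = 1 := by
    rw [← Matrix.mul_kronecker_mul, pauli_mul_self]; simp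
  rw [interaction_mul_local hP j]
  · obtain ⟨u, hu⟩ := exists_interaction_off α j
    rw [hu, traceSystem_mul_memory, traceSystem_add, traceSystem_smul, Fin.sum_univ_three]
    simp only [traceSystem_add, traceSystem_smul, pauliPair, traceSystem_kronecker, trace_pauli,
      ← Matrix.one_kronecker_one (α := ℂ) (m := Fin 2) (n := Fin 2)]
    simp [Matrix.trace_one, smul_smul, mul_comm]
  · intro k
    simp only [pauliPair, ← Matrix.mul_kronecker_mul, pauli_conj, Matrix.smul_kronecker,
      one_mul, mul_one]

theorem traceMemory_interaction_pauli (α : Fin 3 → ℝ) (j : Fin 3) :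
    traceMemory (interaction α * ((1 : Qubit) ⊗ₖ pauli j) * (interaction α).conjTranspose) =
      (2 * shrink α j : ℂ) • pauli j := by
  have hP : ((1 : Qubit) ⊗ₖ pauli j) * ((1 : Qubit) ⊗ₖ pauli j) = 1 := by
    rw [← Matrix.mul_kronecker_mul, pauli_mul_self]; simp
  rw [interaction_mul_local hP j]
  · obtain ⟨u, hu⟩ := exists_interaction_off α j
    rw [hu, traceMemory_mul_system, traceMemory_add, traceMemory_smul, Fin.sum_univ_three]
    simp only [traceMemory_add, traceMemory_smul, pauliPair, traceMemory_kronecker, trace_pauli,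
      ← Matrix.one_kronecker_one (α := ℂ) (m := Fin 2) (n := Fin 2)]
    simp [Matrix.trace_one, smul_smul, mul_comm]
  · intro k
    simp only [pauliPair, ← Matrix.mul_kronecker_mul, pauli_conj, Matrix.kronecker_smul,
      one_mul, mul_one]

theorem traceSystem_interaction (α r : Fin 3 → ℝ) :
    traceSystem (interaction α * (pauliVec r ⊗ₖ (1 : Qubit)) * (interaction α).conjTranspose) =
      (2 : ℂ) • pauliVec (shrink α * r) := by
  simp only [pauliVec, Fin.sum_univ_three, Matrix.add_kronecker, Matrix.smul_kronecker, mul_add,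
    add_mul, mul_smul_comm, smul_mul_assoc, traceSystem_add, traceSystem_smul,
    traceSystem_interaction_pauli, Pi.mul_apply]
  push_cast
  module

theorem traceMemory_interaction (α r : Fin 3 → ℝ) :
    traceMemory (interaction α * ((1 : Qubit) ⊗ₖ pauliVec r) * (interaction α).conjTranspose) =
      (2 : ℂ) • pauliVec (shrink α * r) := by
  simp only [pauliVec, Fin.sum_univ_three, Matrix.kronecker_add, Matrix.kronecker_smul, mul_add,
    add_mul, mul_smul_comm, smul_mul_assoc, traceMemory_add, traceMemory_smul,
    traceMemory_interaction_pauli, Pi.mul_apply]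
  push_cast
  module

/-! ### Bloch vectors -/

theorem pauliVec_eq (r : Fin 3 → ℝ) :
    pauliVec r = !![(r 2 : ℂ), r 0 - r 1 * Complex.I; r 0 + r 1 * Complex.I, -r 2] := by
  ext a b
  fin_cases a <;> fin_cases b <;> simp [pauliVec, pauli, Fin.sum_univ_three, sub_eq_add_neg]

theorem exists_pauliVec {H : Qubit} (hH : H.IsHermitian) (ht : H.trace = 0) :
    ∃ h, H = pauliVec h := by
  refine ⟨![(H 0 1).re, -(H 0 1).im, (H 0 0).re], ?_⟩
  have h00 := hH.apply 0 0
  have h10 := hH.apply 1 0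
  rw [Matrix.trace, Fin.sum_univ_two] at ht
  simp only [Matrix.diag_apply] at ht
  have h0 : ((H 0 0).re : ℂ) = H 0 0 := Complex.conj_eq_iff_re.mp h00
  rw [pauliVec_eq]
  ext a b
  fin_cases a <;> fin_cases b
  · simp [h0]
  · simp [Complex.re_add_im]
  · simp [← h10, Complex.ext_iff]
  · simp [h0, eq_neg_of_add_eq_zero_right ht]

theorem trace_pauliVec (r : Fin 3 → ℝ) : (pauliVec r).trace = 0 := by
  simp [pauliVec_eq, Matrix.trace]

theorem isHermitian_pauliVec (r : Fin 3 → ℝ) : (pauliVec r).conjTranspose = pauliVec r := by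
  simp [pauliVec, Matrix.conjTranspose_sum, isHermitian_pauli]

theorem trace_pauliVec_mul (a b : Fin 3 → ℝ) :
    (pauliVec a * pauliVec b).trace = 2 * ((a ⬝ᵥ b : ℝ) : ℂ) := by
  simp [pauliVec_eq, Matrix.trace, dotProduct, Fin.sum_univ_three]
  linear_combination (-2 * a 1 * b 1 : ℂ) * Complex.I_sq

/-- The trace sees the orientation of three Bloch vectors, so its conjugation invariance yields
determinant 1 and not merely ±1. -/
theorem trace_pauliVec_mul_mul (h : Fin 3 → Fin 3 → ℝ) :
    (pauliVec (h 0) * pauliVec (h 1) * pauliVec (h 2)).trace =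
      2 * Complex.I * ((Matrix.of h).det : ℂ) := by
  simp [pauliVec_eq, Matrix.trace, Matrix.det_fin_three]
  ring

theorem pauli_eq_pauliVec (j : Fin 3) : pauli j = pauliVec (Pi.single j 1) := by
  simp [pauliVec, Pi.single_apply]

/-- Conjugation by a unitary rotates the Bloch vector. -/
theorem exists_isBlochRotation {V : Qubit} (hV : V ∈ Matrix.unitaryGroup (Fin 2) ℂ) :
    ∃ R ∈ Matrix.specialOrthogonalGroup (Fin 3) ℝ, IsBlochRotation V R := by
  have hV' : V.conjTranspose * V = 1 := Matrix.mem_unitaryGroup_iff'.mp hV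
  have hconj : ∀ A B : Qubit, V * A * V.conjTranspose * (V * B * V.conjTranspose) =
      V * (A * B) * V.conjTranspose := fun A B => by
    calc _ = V * A * (V.conjTranspose * V) * B * V.conjTranspose := by simp only [mul_assoc]
      _ = _ := by rw [hV']; simp only [mul_assoc, one_mul]
  have htr : ∀ A : Qubit, (V * A * V.conjTranspose).trace = A.trace := fun A => by
    rw [Matrix.trace_mul_cycle, hV', one_mul]
  have hex : ∀ k, ∃ h, V * pauli k * V.conjTranspose = pauliVec h := fun k => by
    refine exists_pauliVec ?_ (by rw [htr, trace_pauli])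
    rw [Matrix.IsHermitian]
    simp [isHermitian_pauli, mul_assoc]
  choose h hh using hex
  have hdot : ∀ k l, h k ⬝ᵥ h l = if k = l then 1 else 0 := fun k l => by
    have h1 := trace_pauliVec_mul (h k) (h l)
    rw [← hh, ← hh, hconj, htr, pauli_eq_pauliVec, pauli_eq_pauliVec, trace_pauliVec_mul] at h1
    have h2 := mul_left_cancel₀ two_ne_zero h1
    rw [← Complex.ofReal_inj, ← h2]
    simp [Pi.single_apply, eq_comm]
  have hdet : (Matrix.of h).det = 1 := by
    have h1 := trace_pauliVec_mul_mul h
    rw [← hh, ← hh, ← hh, hconj, hconj, htr, pauli_mul_pauli.1, smul_mul_assoc, pauli_mul_self,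
      Matrix.trace_smul, Matrix.trace_one] at h1
    have h2 : (2 * Complex.I) * ((Matrix.of h).det : ℂ) = (2 * Complex.I) * 1 := by
      rw [← h1]; simp [mul_comm]
    exact_mod_cast mul_left_cancel₀ (by simp) h2
  refine ⟨(Matrix.of h).transpose, ?_, ?_⟩
  · rw [Matrix.mem_specialOrthogonalGroup_iff, Matrix.mem_orthogonalGroup_iff',
      Matrix.det_transpose]
    refine ⟨?_, hdet⟩
    ext k l
    rw [Matrix.one_apply, ← hdot]
    rfl
  · intro r
    have : V * pauliVec r * V.conjTranspose = ∑ k, (r k : ℂ) • pauliVec (h k) := by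
      simp_rw [← hh]
      simp [pauliVec, Finset.mul_sum, Finset.sum_mul]
    rw [this]
    simp only [pauliVec, Fin.sum_univ_three, Matrix.mulVec, dotProduct, Matrix.transpose_apply,
      Matrix.of_apply]
    push_cast
    module

/-! ### Interactions in canonical form -/

theorem interaction_mul_conjTranspose (α : Fin 3 → ℝ) :
    interaction α * (interaction α).conjTranspose = 1 := by
  rw [conjTranspose_interaction, interaction_mul, add_neg_cancel, interaction_eq_exp]
  simp [generator]

theorem IsCanonicalForm.conj {U : TwoQubit} {α : Fin 3 → ℝ} {W₁ W₂ V₁ V₂ : Qubit}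
    (h : IsCanonicalForm U α W₁ W₂ V₁ V₂) (A B : Qubit) :
    U * (A ⊗ₖ B) * U.conjTranspose = (W₂ ⊗ₖ V₂) *
      (interaction α * ((W₁ * A * W₁.conjTranspose) ⊗ₖ (V₁ * B * V₁.conjTranspose)) *
        (interaction α).conjTranspose) * (W₂ ⊗ₖ V₂).conjTranspose := by
  rw [h.eq, Matrix.mul_kronecker_mul, Matrix.mul_kronecker_mul, ← Matrix.conjTranspose_kronecker]
  simp only [Matrix.conjTranspose_mul, mul_assoc]

theorem bloch_conj {V : Qubit} (hV : V ∈ Matrix.unitaryGroup (Fin 2) ℂ)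
    {R : Matrix (Fin 3) (Fin 3) ℝ} (hR : IsBlochRotation V R) (r : Fin 3 → ℝ) :
    V * bloch r * V.conjTranspose = bloch (R.mulVec r) := by
  have hV' : V * V.conjTranspose = 1 := Matrix.mem_unitaryGroup_iff.mp hV
  rw [bloch, bloch, ← hR r, mul_smul_comm, smul_mul_assoc, mul_add, add_mul, mul_one, hV']

theorem traceMemory_interaction_bloch (α r : Fin 3 → ℝ) :
    traceMemory (interaction α * (mixed ⊗ₖ bloch r) * (interaction α).conjTranspose) =
      bloch (shrink α * r) := by
  have h1 : mixed ⊗ₖ bloch r = (1 / 4 : ℂ) • (1 + (1 : Qubit) ⊗ₖ pauliVec r) := by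
    rw [mixed, bloch, Matrix.smul_kronecker, Matrix.kronecker_smul, Matrix.kronecker_add,
      Matrix.one_kronecker_one, smul_smul]
    norm_num
  rw [h1, mul_smul_comm, smul_mul_assoc, mul_add, add_mul, mul_one, interaction_mul_conjTranspose,
    traceMemory_smul, traceMemory_add, traceMemory_interaction, ← Matrix.one_kronecker_one,
    traceMemory_kronecker, Matrix.trace_one, bloch]
  simp only [Fintype.card_fin, Nat.cast_ofNat]
  module

/-- The Bloch form of the system channel at the completely mixed memory. -/
theorem IsCanonicalForm.systemChannel_bloch {U : TwoQubit} {α : Fin 3 → ℝ} {W₁ W₂ V₁ V₂ : Qubit}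
    (h : IsCanonicalForm U α W₁ W₂ V₁ V₂) {R₁ R₂ : Matrix (Fin 3) (Fin 3) ℝ}
    (h₁ : IsBlochRotation V₁ R₁) (h₂ : IsBlochRotation V₂ R₂) (r : Fin 3 → ℝ) :
    systemChannel U mixed (bloch r) =
      bloch ((R₂ * Matrix.diagonal (shrink α) * R₁).mulVec r) := by
  have hW : W₁ * mixed * W₁.conjTranspose = mixed := by
    have : W₁ * W₁.conjTranspose = 1 := Matrix.mem_unitaryGroup_iff.mp h.memory_in
    rw [mixed, mul_smul_comm, smul_mul_assoc, mul_one, this]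
  change traceMemory _ = _
  rw [h.conj, traceMemory_conj _ _ h.memory_out, hW, bloch_conj h.system_in h₁,
    traceMemory_interaction_bloch, bloch_conj h.system_out h₂, ← Matrix.mulVec_mulVec,
    ← Matrix.mulVec_mulVec]
  congr 2
  ext i
  simp [Matrix.mulVec_diagonal]

/-- The memory channel on traceless Hermitian operators. -/
theorem IsCanonicalForm.memoryChannel_eq {U : TwoQubit} {α : Fin 3 → ℝ} {W₁ W₂ V₁ V₂ : Qubit}
    (h : IsCanonicalForm U α W₁ W₂ V₁ V₂) {A : Qubit} {r : Fin 3 → ℝ}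
    (hr : W₁ * A * W₁.conjTranspose = pauliVec r) :
    memoryChannel U mixed A = W₂ * pauliVec (shrink α * r) * W₂.conjTranspose := by
  have hV : V₁ * V₁.conjTranspose = 1 := Matrix.mem_unitaryGroup_iff.mp h.system_in
  rw [memoryChannel_mixed, h.conj, mul_one, hV, traceSystem_conj _ _ h.system_out, hr,
    traceSystem_interaction, mul_smul_comm, smul_mul_assoc, smul_smul]
  norm_num

theorem trace_conj {W : Qubit} (hW : W ∈ Matrix.unitaryGroup (Fin 2) ℂ) (A : Qubit) :
    (W * A * W.conjTranspose).trace = A.trace := by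
  have hW' : W.conjTranspose * W = 1 := Matrix.mem_unitaryGroup_iff'.mp hW
  rw [Matrix.trace_mul_cycle, hW', one_mul]

theorem conj_mul_conj {W : Qubit} (hW : W ∈ Matrix.unitaryGroup (Fin 2) ℂ) (A B : Qubit) :
    (W * A * W.conjTranspose) * (W * B * W.conjTranspose) = W * (A * B) * W.conjTranspose := by
  have hW' : W.conjTranspose * W = 1 := Matrix.mem_unitaryGroup_iff'.mp hW
  calc _ = W * A * (W.conjTranspose * W) * B * W.conjTranspose := by simp only [mul_assoc]
    _ = _ := by rw [hW']; simp only [mul_assoc, one_mul]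

theorem exists_traceless_fixed {U : TwoQubit}
    (hU : U ∈ Matrix.unitaryGroup (Fin 2 × Fin 2) ℂ)
    (h : ¬ HasUniqueFixedState (memoryChannel U mixed)) :
    ∃ H : Qubit, H.IsHermitian ∧ H.trace = 0 ∧ H ≠ 0 ∧ memoryChannel U mixed H = H := by
  obtain ⟨H, hH, hs, hfix⟩ := exists_fixed_of_not_unique hU h
  have ht : star H.trace = H.trace := by rw [← Matrix.trace_conjTranspose, hH.eq]
  refine ⟨H - (H.trace / 2) • 1, ?_, ?_, sub_ne_zero.mpr (hs _), ?_⟩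
  · rw [Matrix.IsHermitian, Matrix.conjTranspose_sub, Matrix.conjTranspose_smul, hH.eq, star_div₀,
      ht]
    simp
  · rw [Matrix.trace_sub, Matrix.trace_smul, Matrix.trace_one]
    simp
  · rw [← memoryMap_apply, map_sub, map_smul, memoryMap_apply, memoryMap_apply, hfix,
      memoryChannel_mixed_one hU]

/-- Without a unique fixed state, a nonzero Bloch vector is not shrunk by the interaction. -/
theorem IsCanonicalForm.exists_bloch_fixed {U : TwoQubit} {α : Fin 3 → ℝ} {W₁ W₂ V₁ V₂ : Qubit}
    (h : IsCanonicalForm U α W₁ W₂ V₁ V₂) (hU : U ∈ Matrix.unitaryGroup (Fin 2 × Fin 2) ℂ)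
    (hn : ¬ HasUniqueFixedState (memoryChannel U mixed)) :
    ∃ (H : Qubit) (r : Fin 3 → ℝ), H.IsHermitian ∧ H.trace = 0 ∧ H ≠ 0 ∧
      memoryChannel U mixed H = H ∧ H = W₁.conjTranspose * pauliVec r * W₁ ∧
      (∀ j, r j ≠ 0 → shrink α j ^ 2 = 1) ∧ (∃ j, r j ≠ 0) := by
  obtain ⟨H, hH, ht, h0, hfix⟩ := exists_traceless_fixed hU hn
  have hW : W₁.conjTranspose * W₁ = 1 := Matrix.mem_unitaryGroup_iff'.mp h.memory_in
  obtain ⟨r, hr⟩ : ∃ r, W₁ * H * W₁.conjTranspose = pauliVec r := by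
    refine exists_pauliVec ?_ (by rw [trace_conj h.memory_in, ht])
    rw [Matrix.IsHermitian]
    simp [hH.eq, mul_assoc]
  have hHr : H = W₁.conjTranspose * pauliVec r * W₁ := by
    rw [← hr]
    calc H = (W₁.conjTranspose * W₁) * H * (W₁.conjTranspose * W₁) := by rw [hW]; simp
      _ = _ := by simp only [mul_assoc]
  have hC := h.memoryChannel_eq hr
  rw [hfix] at hC
  -- Unitary conjugation preserves Tr H², so the Bloch vector and its shrunk image have equal
  -- length. As no factor exceeds 1 in modulus, each nonzero component must have a factor of modulus
  -- 1.
  have e1 : (H * H).trace = 2 * ((r ⬝ᵥ r : ℝ) : ℂ) := by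
    rw [← trace_conj h.memory_in, ← conj_mul_conj h.memory_in, hr, trace_pauliVec_mul]
  have e2 : (H * H).trace = 2 * (((shrink α * r) ⬝ᵥ (shrink α * r) : ℝ) : ℂ) := by
    rw [hC, conj_mul_conj h.memory_out, trace_conj h.memory_out, trace_pauliVec_mul]
  have e3 : r ⬝ᵥ r = (shrink α * r) ⬝ᵥ (shrink α * r) := by
    rw [e1] at e2
    exact_mod_cast mul_left_cancel₀ two_ne_zero e2
  have hs : ∀ j, shrink α j ^ 2 ≤ 1 := by
    have hc := fun x : ℝ => Real.cos_sq_le_one x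
    intro j
    fin_cases j <;> simp only [shrink, Fin.zero_eta, Fin.mk_one, Fin.reduceFinMk, Matrix.cons_val,
      mul_pow] <;> exact mul_le_one₀ (hc _) (sq_nonneg _) (hc _)
  have e4 : ∑ j, (1 - shrink α j ^ 2) * r j ^ 2 = 0 := by
    simp only [dotProduct, Pi.mul_apply] at e3
    simp only [sub_mul, Finset.sum_sub_distrib, one_mul, sub_eq_zero]
    convert e3 using 2 <;> ring
  have e5 := (Finset.sum_eq_zero_iff_of_nonneg fun j _ =>
    mul_nonneg (sub_nonneg.mpr (hs j)) (sq_nonneg (r j))).mp e4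
  refine ⟨H, r, hH, ht, h0, hfix, hHr, fun j hj => ?_, ?_⟩
  · have := (mul_eq_zero.mp (e5 j (Finset.mem_univ j))).resolve_right (pow_ne_zero 2 hj)
    linarith
  · by_contra! hz
    apply h0
    rw [hHr, show r = 0 from funext hz]
    simp [pauliVec]

theorem eq_zero_of_cos_sq {x : ℝ} (h0 : 0 ≤ x) (h1 : x ≤ Real.pi / 2) (h : Real.cos x ^ 2 = 1) :
    x = 0 := by
  have hc : 0 ≤ Real.cos x := Real.cos_nonneg_of_neg_pi_div_two_le_of_le (by linarith) h1
  have hc1 : Real.cos x = 1 := by nlinarith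
  have := Real.pi_pos
  exact (Real.cos_eq_one_iff_of_lt_of_lt (by linarith) (by linarith)).mp hc1

theorem cos_sq_of_mul {x y : ℝ} (h : (Real.cos x * Real.cos y) ^ 2 = 1) :
    Real.cos x ^ 2 = 1 ∧ Real.cos y ^ 2 = 1 := by
  have hx := Real.cos_sq_le_one x
  have hy := Real.cos_sq_le_one y
  rw [mul_pow] at h
  constructor <;> nlinarith [sq_nonneg (Real.cos x), sq_nonneg (Real.cos y)]

/-- A product of two cosines has modulus 1 only if both do, and on [0, π/2] this forces the angle 0.
The ordering then makes the smaller parameters vanish as well; α_z, which may be negative, is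
reached through |α_z| ≤ α_y. Only the factor for j = 0 omits cos α_x. -/
theorem IsCanonicalForm.shrink_eq {U : TwoQubit} {α : Fin 3 → ℝ} {W₁ W₂ V₁ V₂ : Qubit}
    (h : IsCanonicalForm U α W₁ W₂ V₁ V₂) {j : Fin 3} (hj : shrink α j ^ 2 = 1) :
    α 1 = 0 ∧ α 2 = 0 ∧ (j ≠ 0 → α 0 = 0) := by
  have h1 : 0 ≤ α 1 := (abs_nonneg _).trans h.abs_z_le_y
  have h2 : α 1 = 0 → α 2 = 0 := fun h' => by
    have := h.abs_z_le_y
    rw [h'] at this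
    exact abs_nonpos_iff.mp this
  have hx := h.x_le
  have hxy := h.y_le_x
  have h3 : Real.cos (α 0) ^ 2 = 1 → α 1 = 0 ∧ α 2 = 0 ∧ α 0 = 0 := fun h' => by
    have h0 := eq_zero_of_cos_sq (h1.trans hxy) hx h'
    have : α 1 = 0 := by linarith
    exact ⟨this, h2 this, h0⟩
  fin_cases j <;> simp only [shrink, Fin.zero_eta, Fin.mk_one, Fin.reduceFinMk,
    Matrix.cons_val] at hj
  · have := eq_zero_of_cos_sq h1 (hxy.trans hx) (cos_sq_of_mul hj).1
    exact ⟨this, h2 this, fun h => absurd rfl h⟩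
  · obtain ⟨a, b, c⟩ := h3 (cos_sq_of_mul hj).1
    exact ⟨a, b, fun _ => c⟩
  · obtain ⟨a, b, c⟩ := h3 (cos_sq_of_mul hj).1
    exact ⟨a, b, fun _ => c⟩

theorem exists_reflection_basis {Q : Qubit} (hQ : Q.IsHermitian) (ht : Q.trace = 0)
    (hQQ : Q * Q = 1) :
    ∃ b : OrthonormalBasis (Fin 2) ℂ Ket, Q = ketBra (b 0) - ketBra (b 1) := by
  obtain ⟨b, c, hb⟩ := exists_spectral hQ
  rw [Fin.sum_univ_two] at hb
  have h1 : c 1 = -c 0 := by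
    rw [hb, Matrix.trace_add, Matrix.trace_smul, Matrix.trace_smul, trace_ketBra, trace_ketBra]
      at ht
    simp only [smul_eq_mul, mul_one] at ht
    exact eq_neg_of_add_eq_zero_right (by exact_mod_cast ht)
  have h2 : c 0 ^ 2 = 1 := by
    have hsum := sum_ketBra b
    rw [Fin.sum_univ_two] at hsum
    have hsq : Q * Q = ((c 0 : ℂ) * c 0) • (1 : Qubit) := by
      rw [hb, h1, ← hsum]
      have h01 : ketBra (b 0) * ketBra (b 1) = 0 := by simp [ketBra_mul_ketBra]
      have h10 : ketBra (b 1) * ketBra (b 0) = 0 := by simp [ketBra_mul_ketBra]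
      simp only [add_mul, mul_add, smul_mul_smul_comm, ketBra_mul_self, h01, h10]
      push_cast
      module
    rw [hQQ] at hsq
    have := congrFun (congrFun hsq 0) 0
    simp only [Matrix.smul_apply, Matrix.one_apply_eq, smul_eq_mul, mul_one] at this
    rw [sq]
    exact_mod_cast this.symm
  rcases (sq_eq_sq_iff_eq_or_eq_neg.mp (h2.trans (one_pow 2).symm)) with h0 | h0
  · exact ⟨b, by rw [hb, h1, h0]; push_cast; module⟩
  -- Here the eigenvalue −1 came first; exchanging the basis vectors restores the sign convention.
  · refine ⟨b.reindex (Equiv.swap 0 1), ?_⟩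
    rw [hb, h1, h0]
    simp
    abel

/-- The controlled form of an interaction with only one nonzero parameter. -/
theorem IsCanonicalForm.controlled_form {U : TwoQubit} {α : Fin 3 → ℝ} {W₁ W₂ V₁ V₂ : Qubit}
    (h : IsCanonicalForm U α W₁ W₂ V₁ V₂) (h1 : α 1 = 0) (h2 : α 2 = 0)
    (b : OrthonormalBasis (Fin 2) ℂ Ket)
    (hcomm : ∀ l, (W₂ * W₁) * ketBra (b l) = ketBra (b l) * (W₂ * W₁))
    (hX : Complex.sinh (Complex.I / 2 * α 0) • (W₂ * pauli 0 * W₁) =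
      Complex.sinh (Complex.I / 2 * α 0) • ((W₂ * W₁) * (ketBra (b 0) - ketBra (b 1)))) :
    ∃ c : Fin 2 → ℂ, (∀ l, ‖c l‖ = 1) ∧
      U = c 0 • (ketBra (b 0) ⊗ₖ
            (V₂ * NormedSpace.exp ((Complex.I * (α 0 / 2 : ℝ)) • pauli 0) * V₁)) +
          c 1 • (ketBra (b 1) ⊗ₖ
            (V₂ * NormedSpace.exp ((-Complex.I * (α 0 / 2 : ℝ)) • pauli 0) * V₁)) := by
  have hG : W₂ * W₁ ∈ Matrix.unitaryGroup (Fin 2) ℂ := mul_mem h.memory_out h.memory_in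
  choose c hc hcb using fun l => exists_phase hG b l (hcomm l)
  refine ⟨c, hc, ?_⟩
  have hG' : W₂ * W₁ = c 0 • ketBra (b 0) + c 1 • ketBra (b 1) := by
    rw [← hcb, ← hcb, ← mul_add, ← Fin.sum_univ_two fun l => ketBra (b l), sum_ketBra, mul_one]
  rw [mul_sub, hcb, hcb] at hX
  have hz : Complex.I * (α 0 / 2 : ℝ) = Complex.I / 2 * α 0 := by push_cast; ring
  have hz' : -Complex.I * (α 0 / 2 : ℝ) = -(Complex.I / 2 * α 0) := by push_cast; ring
  rw [hz, hz', exp_smul_of_mul_self_eq_one (pauli_mul_self 0),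
    exp_smul_of_mul_self_eq_one (pauli_mul_self 0), Complex.cosh_neg, Complex.sinh_neg, h.eq,
    interaction_eq_prod, h1, h2]
  set C := Complex.cosh (Complex.I / 2 * α 0)
  set S := Complex.sinh (Complex.I / 2 * α 0)
  simp only [Complex.ofReal_zero, mul_zero, Complex.cosh_zero, Complex.sinh_zero, zero_smul,
    add_zero, one_smul, mul_one, mul_add, add_mul, mul_smul_comm, smul_mul_assoc, pauliPair,
    ← Matrix.mul_kronecker_mul]
  rw [← Matrix.smul_kronecker S, hX, hG']
  simp only [Matrix.smul_kronecker, Matrix.kronecker_smul, Matrix.add_kronecker,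
    Matrix.kronecker_add, smul_add, sub_eq_add_neg, ← neg_smul]
  module

/-- Without a unique fixed state, the interaction is controlled by the memory, in canonical form. -/
theorem IsCanonicalForm.of_not_unique {U : TwoQubit} {α : Fin 3 → ℝ} {W₁ W₂ V₁ V₂ : Qubit}
    (h : IsCanonicalForm U α W₁ W₂ V₁ V₂) (hU : U ∈ Matrix.unitaryGroup (Fin 2 × Fin 2) ℂ)
    (hn : ¬ HasUniqueFixedState (memoryChannel U mixed)) :
    α 1 = 0 ∧ α 2 = 0 ∧ ∃ (b : OrthonormalBasis (Fin 2) ℂ Ket) (c : Fin 2 → ℂ),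
      (∀ l, ‖c l‖ = 1) ∧
      U = c 0 • (ketBra (b 0) ⊗ₖ
            (V₂ * NormedSpace.exp ((Complex.I * (α 0 / 2 : ℝ)) • pauli 0) * V₁)) +
          c 1 • (ketBra (b 1) ⊗ₖ
            (V₂ * NormedSpace.exp ((-Complex.I * (α 0 / 2 : ℝ)) • pauli 0) * V₁)) := by
  obtain ⟨H, r, hH, ht, h0, hfix, hHr, hs, j, hj⟩ := h.exists_bloch_fixed hU hn
  obtain ⟨h1, h2, -⟩ := h.shrink_eq (hs j hj)
  refine ⟨h1, h2, ?_⟩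
  have hW : W₁ * W₁.conjTranspose = 1 := Matrix.mem_unitaryGroup_iff.mp h.memory_in
  have hW2 : W₂.conjTranspose * W₂ = 1 := Matrix.mem_unitaryGroup_iff'.mp h.memory_out
  have hconj : ∀ A, W₁ * (W₁.conjTranspose * A * W₁) * W₁.conjTranspose = A := fun A => by
    calc _ = (W₁ * W₁.conjTranspose) * A * (W₁ * W₁.conjTranspose) := by simp only [mul_assoc]
      _ = A := by rw [hW]; simp
  by_cases hα : α 0 = 0
  · have hns : ∀ c : ℂ, H ≠ c • 1 := by
      rintro c rfl
      rw [Matrix.trace_smul, Matrix.trace_one] at ht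
      apply h0
      have : c = 0 := by simpa using ht
      rw [this, zero_smul]
    obtain ⟨b, hb⟩ := exists_basis_commute hH hns
    -- For α_x = 0 the factor sinh vanishes and the condition on W₂σₓW₁ is void. The interaction is
    -- a product unitary, so an eigenbasis of H, which commutes with W₂W₁, suffices.
    refine ⟨b, h.controlled_form h1 h2 b ?_ (by simp [hα])⟩
    have hU1 : U = (W₂ * W₁) ⊗ₖ (V₂ * V₁) := by
      rw [h.eq, interaction_eq_prod, h1, h2, hα]
      simp [Matrix.mul_kronecker_mul]
    have hV : (V₂ * V₁) * (V₂ * V₁).conjTranspose = 1 :=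
      Matrix.mem_unitaryGroup_iff.mp (mul_mem h.system_out h.system_in)
    have hc := commute_of_fixed hU hH hfix
    rw [hU1, ← Matrix.mul_kronecker_mul, ← Matrix.mul_kronecker_mul, mul_one, one_mul] at hc
    have hc2 := congrArg (fun A => traceSystem (A * ((1 : Qubit) ⊗ₖ (V₂ * V₁).conjTranspose))) hc
    simp only [← Matrix.mul_kronecker_mul, hV, mul_one, traceSystem_kronecker] at hc2
    have hc3 : (W₂ * W₁) * H = H * (W₂ * W₁) := by
      refine smul_right_injective _ (r := (1 : Qubit).trace) ?_ hc2
      simp [Matrix.trace_one]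
    intro l
    obtain ⟨x, y, hl⟩ := hb l
    rw [hl, mul_add, add_mul, mul_smul_comm, hc3]
    simp
  -- For α_x ≠ 0 only the x component escapes shrinking, so H is a multiple of W₁†σₓW₁. That H is
  -- fixed then says W₁†σₓW₁ = W₂σₓW₂†; the eigenbasis of this reflection is the control basis.
  · have hr : r = Pi.single 0 (r 0) := by
      funext k
      by_cases hk : k = 0
      · subst hk; simp
      · rw [Pi.single_eq_of_ne hk]
        by_contra hne
        exact hα ((h.shrink_eq (hs k hne)).2.2 hk)
    have hr0 : r 0 ≠ 0 := by
      intro h00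
      rw [hr, h00] at hj
      simp at hj
    have hpr : pauliVec r = (r 0 : ℂ) • pauli 0 := by
      rw [hr]; simp [pauliVec, Pi.single_apply]
    have hsr : shrink α * r = r := by
      rw [hr]
      funext k
      by_cases hk : k = 0
      · subst hk; simp [shrink, h1, h2]
      · simp [Pi.single_eq_of_ne hk]
    have hrC : (r 0 : ℂ) ≠ 0 := by exact_mod_cast hr0
    set Q := W₁.conjTranspose * pauli 0 * W₁ with hQ
    have hC : Q = W₂ * pauli 0 * W₂.conjTranspose := by
      have := h.memoryChannel_eq (A := H) (r := r) (by rw [hHr, hconj])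
      rw [hfix, hsr, hHr, hpr] at this
      simp only [mul_smul_comm, smul_mul_assoc] at this
      exact smul_right_injective _ hrC this
    have hQH : Q.IsHermitian := by
      rw [Matrix.IsHermitian, hQ]
      simp [isHermitian_pauli, mul_assoc]
    have hQt : Q.trace = 0 := by rw [hC, trace_conj h.memory_out, trace_pauli]
    have hQQ : Q * Q = 1 := by
      have : W₂ * W₂.conjTranspose = 1 := Matrix.mem_unitaryGroup_iff.mp h.memory_out
      rw [hC, conj_mul_conj h.memory_out, pauli_mul_self, mul_one, this]
    obtain ⟨b, hb⟩ := exists_reflection_basis hQH hQt hQQ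
    have hXW : W₂ * pauli 0 * W₁ = (W₂ * W₁) * Q := by
      rw [hQ]
      calc _ = W₂ * (W₁ * W₁.conjTranspose) * pauli 0 * W₁ := by rw [hW, mul_one]
        _ = _ := by simp only [mul_assoc]
    have hXW' : W₂ * pauli 0 * W₁ = Q * (W₂ * W₁) := by
      rw [hC]
      calc _ = W₂ * pauli 0 * (W₂.conjTranspose * W₂) * W₁ := by rw [hW2, mul_one]
        _ = _ := by simp only [mul_assoc]
    have hGQ := hXW.symm.trans hXW'
    refine ⟨b, h.controlled_form h1 h2 b ?_ (by rw [hXW, hb])⟩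
    have hsum := sum_ketBra b
    rw [Fin.sum_univ_two] at hsum
    intro l
    have hl : ∃ s : ℂ, ketBra (b l) = (1 / 2 : ℂ) • 1 + s • Q := by
      fin_cases l
      · refine ⟨1 / 2, ?_⟩
        rw [hb, ← hsum]
        change ketBra (b 0) = _
        module
      · refine ⟨-1 / 2, ?_⟩
        rw [hb, ← hsum]
        change ketBra (b 1) = _
        module
    obtain ⟨s, hl⟩ := hl
    rw [hl, mul_add, add_mul, mul_smul_comm s, hGQ]
    simp

/-! ### Averages of martingale differences along a random record -/

section Record

variable {A : Type*}

/-- Extend a finite word to an infinite one. -/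
noncomputable def extendWord [Nonempty A] {n : ℕ} (u : Fin n → A) (j : ℕ) : A :=
  if h : j < n then u ⟨j, h⟩ else Classical.arbitrary A

theorem extendWord_snoc [Nonempty A] {n : ℕ} (u : Fin n → A) (a : A) :
    extendWord (Fin.snoc u a : Fin (n + 1) → A) = Function.update (extendWord u) n a := by
  funext j
  rcases lt_trichotomy j n with h | h | h
  · rw [Function.update_of_ne h.ne, extendWord, extendWord, dif_pos (by omega), dif_pos h]
    simp [Fin.snoc, h]
  · subst h
    simp [extendWord, Fin.snoc]
  · rw [Function.update_of_ne h.ne', extendWord, extendWord, dif_neg (by omega),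
      dif_neg (by omega)]

/-- Over a finite alphabet, a function of a prefix takes finitely many values, each on a cylinder of
known probability. Expectations become finite sums over words, so no filtration or conditional
expectation is needed. -/
theorem eq_sum_indicator [Fintype A] [Nonempty A] {Ω : Type*} {ev : ℕ → Ω → A} {n : ℕ}
    {F : (ℕ → A) → ℝ} (hF : DependsOn F (Set.Iio n)) (ω : Ω) :
    F (fun j => ev j ω) = ∑ u : Fin n → A,
      {ω | ∀ j < n, ev j ω = extendWord u j}.indicator (fun _ => F (extendWord u)) ω := by
  classical
  rw [Finset.sum_eq_single (fun i : Fin n => ev i ω)]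
  · rw [Set.indicator_of_mem]
    · exact hF fun j hj => by simp [extendWord, Set.mem_Iio.mp hj]
    · intro j hj; simp [extendWord, hj]
  · intro u _ hu
    refine Set.indicator_of_notMem (fun h => hu ?_) _
    funext i
    have := h i i.2
    simp only [extendWord, i.2, dif_pos] at this
    exact this.symm
  · simp

theorem dependsOn_sum_range {d : ℕ → (ℕ → A) → ℂ}
    (hd : ∀ n, DependsOn (d n) (Set.Iio (n + 1))) (n : ℕ) :
    DependsOn (fun w => ∑ j ∈ Finset.range n, d j w) (Set.Iio n) := fun _ _ hw =>
  Finset.sum_congr rfl fun j hj => hd j fun i hi => hw i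
    (lt_of_lt_of_le (Set.mem_Iio.mp hi) (Finset.mem_range.mp hj))

variable {Ω : Type*} [MeasurableSpace Ω] {μ : Measure Ω} {ev : ℕ → Ω → A} {P : (ℕ → A) → ℕ → ℝ}

/-- The law `μ` of the random record `ev` gives the prefix of `w` of length `n` the
probability `P w n`. -/
structure HasPrefixLaw (μ : Measure Ω) (ev : ℕ → Ω → A) (P : (ℕ → A) → ℕ → ℝ) : Prop where
  measurable : ∀ j e, MeasurableSet {ω | ev j ω = e}
  nonneg : ∀ w n, 0 ≤ P w n
  law : ∀ n w, μ {ω | ∀ j < n, ev j ω = w j} = ENNReal.ofReal (P w n)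

theorem HasPrefixLaw.measurableSet_prefix (h : HasPrefixLaw μ ev P) (n : ℕ) (w : ℕ → A) :
    MeasurableSet {ω | ∀ j < n, ev j ω = w j} := by
  simp only [Set.ofPred_forall]
  exact MeasurableSet.iInter fun j => MeasurableSet.iInter fun _ => h.measurable j (w j)

variable [Fintype A] [Nonempty A]

theorem HasPrefixLaw.integrable [IsProbabilityMeasure μ] (h : HasPrefixLaw μ ev P) {n : ℕ}
    {F : (ℕ → A) → ℝ} (hF : DependsOn F (Set.Iio n)) :
    Integrable (fun ω => F (fun j => ev j ω)) μ := by
  simp_rw [eq_sum_indicator (ev := ev) hF]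
  exact integrable_finsetSum _ fun u _ =>
    (integrable_const _).indicator (h.measurableSet_prefix n _)

theorem HasPrefixLaw.integral_eq [IsProbabilityMeasure μ] (h : HasPrefixLaw μ ev P) {n : ℕ}
    {F : (ℕ → A) → ℝ} (hF : DependsOn F (Set.Iio n)) :
    ∫ ω, F (fun j => ev j ω) ∂μ =
      ∑ u : Fin n → A, P (extendWord u) n * F (extendWord u) := by
  simp_rw [eq_sum_indicator (ev := ev) hF]
  rw [integral_finsetSum _ fun u _ =>
    (integrable_const _).indicator (h.measurableSet_prefix n _)]
  refine Finset.sum_congr rfl fun u _ => ?_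
  rw [integral_indicator_const _ (h.measurableSet_prefix n _), measureReal_def, h.law,
    ENNReal.toReal_ofReal (h.nonneg _ _), smul_eq_mul]

/-- A function of the first `n + 1` letters whose conditional mean vanishes has mean zero. -/
theorem HasPrefixLaw.integral_eq_zero [IsProbabilityMeasure μ] (h : HasPrefixLaw μ ev P) {n : ℕ}
    {F : (ℕ → A) → ℝ} (hF : DependsOn F (Set.Iio (n + 1)))
    (hz : ∀ w, ∑ a, P (Function.update w n a) (n + 1) * F (Function.update w n a) = 0) :
    ∫ ω, F (fun j => ev j ω) ∂μ = 0 := by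
  rw [h.integral_eq hF, ← (Fin.snocEquiv fun _ => A).sum_comp, Fintype.sum_prod_type_right]
  refine Finset.sum_eq_zero fun v _ => ?_
  refine Eq.trans (Finset.sum_congr rfl fun a _ => ?_) (hz (extendWord v))
  rw [← extendWord_snoc]
  rfl

/-- Normalized states have a meaningless default value on prefixes of probability zero; almost every
record avoids all of them, since there are only finitely many words of each length. -/
theorem HasPrefixLaw.ae_ne_zero [IsProbabilityMeasure μ] (h : HasPrefixLaw μ ev P)
    (hP : ∀ n, DependsOn (fun w => P w n) (Set.Iio n)) :
    ∀ᵐ ω ∂μ, ∀ n, P (fun j => ev j ω) n ≠ 0 := by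
  rw [ae_all_iff]
  intro n
  classical
  have hF : DependsOn (fun w => if P w n = 0 then (1 : ℝ) else 0) (Set.Iio n) := fun w w' hw => by
    simp only [show P w n = P w' n from hP n hw]
  have h0 : ∫ ω, (if P (fun j => ev j ω) n = 0 then (1 : ℝ) else 0) ∂μ = 0 := by
    rw [h.integral_eq hF]
    refine Finset.sum_eq_zero fun u _ => ?_
    split_ifs with hu <;> simp [hu]
  rw [integral_eq_zero_iff_of_nonneg (fun ω => by dsimp only; split_ifs <;> simp)
    (h.integrable hF)] at h0
  filter_upwards [h0] with ω hω hzero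
  simp [hzero] at hω

variable {d : ℕ → (ℕ → A) → ℂ}

/-- Orthogonality of martingale differences: the second moment of their sum grows linearly. -/
theorem HasPrefixLaw.integral_normSq_sum_le [IsProbabilityMeasure μ] (h : HasPrefixLaw μ ev P)
    (hd : ∀ n, DependsOn (d n) (Set.Iio (n + 1))) {B : ℝ} (hB : ∀ n w, ‖d n w‖ ≤ B)
    (hz : ∀ n w, ∑ a, (P (Function.update w n a) (n + 1) : ℂ) * d n (Function.update w n a) = 0)
    (n : ℕ) :
    ∫ ω, Complex.normSq (∑ j ∈ Finset.range n, d j fun i => ev i ω) ∂μ ≤ B ^ 2 * n := by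
  induction n with
  | zero => simp
  | succ n ih =>
    have hS := dependsOn_sum_range hd n
    have hS' : DependsOn (fun w => ∑ j ∈ Finset.range n, d j w) (Set.Iio (n + 1)) :=
      hS.mono (Set.Iio_subset_Iio n.le_succ)
    have h1 : DependsOn (fun w => Complex.normSq (∑ j ∈ Finset.range n, d j w))
        (Set.Iio n) := fun w w' hw => congrArg Complex.normSq (hS hw)
    have h2 : DependsOn (fun w => Complex.normSq (d n w)) (Set.Iio (n + 1)) :=
      fun w w' hw => congrArg Complex.normSq (hd n hw)
    have h3 : DependsOn (fun w => (∑ j ∈ Finset.range n, d j w) * starRingEnd ℂ (d n w) |>.re)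
        (Set.Iio (n + 1)) := fun w w' hw => by
      have e1 : ∑ j ∈ Finset.range n, d j w = ∑ j ∈ Finset.range n, d j w' := hS' hw
      dsimp only
      rw [e1, hd n hw]
    -- The earlier sum does not see the last letter, so it factors out of the vanishing conditional
    -- mean of the new difference.
    have hzero : ∫ ω, ((∑ j ∈ Finset.range n, d j fun i => ev i ω) *
        starRingEnd ℂ (d n fun i => ev i ω)).re ∂μ = 0 := by
      refine h.integral_eq_zero h3 fun w => ?_
      have e : ∀ a, ∑ j ∈ Finset.range n, d j (Function.update w n a) =
          ∑ j ∈ Finset.range n, d j w := fun a =>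
        hS fun i hi => Function.update_of_ne (Set.mem_Iio.mp hi).ne _ _
      have hw := congrArg (fun z => ((∑ j ∈ Finset.range n, d j w) * starRingEnd ℂ z).re) (hz n w)
      simp only [map_sum, map_mul, Complex.conj_ofReal, Finset.mul_sum, Complex.re_sum, map_zero,
        mul_zero, Complex.zero_re] at hw
      rw [← hw]
      refine Finset.sum_congr rfl fun a _ => ?_
      rw [e, mul_left_comm, Complex.re_ofReal_mul]
    have hle : ∫ ω, Complex.normSq (d n fun i => ev i ω) ∂μ ≤ B ^ 2 := by
      have := integral_mono (h.integrable h2) (integrable_const (B ^ 2)) fun ω => by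
        rw [Complex.normSq_eq_norm_sq]
        exact pow_le_pow_left₀ (norm_nonneg _) (hB _ _) 2
      simpa using this
    simp_rw [Finset.sum_range_succ, Complex.normSq_add]
    have h12 : Integrable (fun ω => Complex.normSq (∑ j ∈ Finset.range n, d j fun i => ev i ω) +
        Complex.normSq (d n fun i => ev i ω)) μ := (h.integrable h1).add (h.integrable h2)
    rw [integral_add h12 ((h.integrable h3).const_mul 2),
      integral_add (h.integrable h1) (h.integrable h2), integral_const_mul, hzero]
    push_cast
    linarith

/-- Bounded increments turn convergence of the averages along the squares into convergence. -/
theorem tendsto_average_of_squares {s : ℕ → ℂ} {B : ℝ} (hB : ∀ n, ‖s n‖ ≤ B)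
    (h : Tendsto (fun k : ℕ => ‖∑ j ∈ Finset.range (k ^ 2), s j‖ / (k : ℝ) ^ 2) atTop (𝓝 0)) :
    Tendsto (fun n : ℕ => (n : ℂ)⁻¹ * ∑ j ∈ Finset.range n, s j) atTop (𝓝 0) := by
  have hB0 : 0 ≤ B := (norm_nonneg _).trans (hB 0)
  have hsqrt : Tendsto Nat.sqrt atTop atTop :=
    tendsto_atTop.mpr fun b => eventually_atTop.mpr ⟨b ^ 2, fun n hn => Nat.le_sqrt'.mpr hn⟩
  have hlim : Tendsto (fun k : ℕ => ‖∑ j ∈ Finset.range (k ^ 2), s j‖ / (k : ℝ) ^ 2 +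
      2 * B * (k : ℝ)⁻¹) atTop (𝓝 0) := by
    have := h.add ((tendsto_inv_atTop_nhds_zero_nat (𝕜 := ℝ)).const_mul (2 * B))
    simpa using this
  refine squeeze_zero_norm' ?_ (hlim.comp hsqrt)
  filter_upwards [eventually_ge_atTop 1] with n hn
  simp only [Function.comp]
  set k := Nat.sqrt n with hk
  have hk1 : 1 ≤ k := Nat.le_sqrt'.mpr (by simpa using hn)
  have hk2 : k ^ 2 ≤ n := Nat.sqrt_le' n
  -- Consecutive squares leave a gap of at most 2k terms, which add at most 2Bk to the sum and 2B/k
  -- to the average.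
  have hk3 : n ≤ k ^ 2 + 2 * k := by
    have : n < (k + 1) ^ 2 := Nat.lt_succ_sqrt' n
    nlinarith
  have hsplit : ‖∑ j ∈ Finset.range n, s j‖ ≤
      ‖∑ j ∈ Finset.range (k ^ 2), s j‖ + 2 * B * k := by
    rw [← Finset.sum_range_add_sum_Ico _ hk2]
    refine (norm_add_le _ _).trans (add_le_add le_rfl ?_)
    calc _ ≤ ∑ _j ∈ Finset.Ico (k ^ 2) n, B := norm_sum_le_of_le _ fun j _ => hB j
      _ = ((n - k ^ 2 : ℕ) : ℝ) * B := by simp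
      _ ≤ (2 * k : ℕ) * B := by
        refine mul_le_mul_of_nonneg_right ?_ hB0
        exact_mod_cast (by omega : n - k ^ 2 ≤ 2 * k)
      _ = 2 * B * k := by push_cast; ring
  have hkR : (0 : ℝ) < k := by exact_mod_cast hk1
  have hkn : ((k : ℝ) ^ 2) ≤ n := by exact_mod_cast hk2
  rw [norm_mul, norm_inv, Complex.norm_natCast, inv_mul_eq_div]
  calc ‖∑ j ∈ Finset.range n, s j‖ / n
      ≤ (‖∑ j ∈ Finset.range (k ^ 2), s j‖ + 2 * B * k) / (k : ℝ) ^ 2 := by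
        gcongr
    _ = _ := by field_simp

/-- The strong law of large numbers for bounded martingale differences along a random record. -/
theorem HasPrefixLaw.ae_tendsto_average [IsProbabilityMeasure μ] (h : HasPrefixLaw μ ev P)
    (hd : ∀ n, DependsOn (d n) (Set.Iio (n + 1))) {B : ℝ} (hB : ∀ n w, ‖d n w‖ ≤ B)
    (hz : ∀ n w, ∑ a, (P (Function.update w n a) (n + 1) : ℂ) * d n (Function.update w n a) = 0) :
    ∀ᵐ ω ∂μ, Tendsto (fun n : ℕ => (n : ℂ)⁻¹ * ∑ j ∈ Finset.range n, d j fun i => ev i ω)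
      atTop (𝓝 0) := by
  -- This is the squared modulus of the average over k² runs. Its mean is at most B²/k², which is
  -- summable, so the series of these variables is almost surely finite and its terms tend to 0.
  set f : ℕ → Ω → ℝ := fun k ω =>
    Complex.normSq (∑ j ∈ Finset.range (k ^ 2), d j fun i => ev i ω) / (k : ℝ) ^ 4 with hf
  have hint : ∀ k, Integrable (f k) μ := fun k =>
    (h.integrable (F := fun w => Complex.normSq (∑ j ∈ Finset.range (k ^ 2), d j w))
      (n := k ^ 2) fun w w' hw => congrArg Complex.normSq (dependsOn_sum_range hd _ hw)).div_const _
  have hf0 : ∀ k ω, 0 ≤ f k ω := fun k ω => div_nonneg (Complex.normSq_nonneg _) (by positivity)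
  have hfi : ∀ k, ∫ ω, f k ω ∂μ ≤ B ^ 2 * (1 / (k : ℝ) ^ 2) := fun k => by
    have := h.integral_normSq_sum_le hd hB hz (k ^ 2)
    rw [hf]
    simp only
    rw [integral_div]
    rcases Nat.eq_zero_or_pos k with rfl | hk
    · simp
    · have hk' : (0 : ℝ) < k := by exact_mod_cast hk
      calc _ ≤ (B ^ 2 * ((k ^ 2 : ℕ) : ℝ)) / (k : ℝ) ^ 4 := by gcongr
        _ = _ := by push_cast; field_simp
  have hsum : Summable fun k : ℕ => B ^ 2 * (1 / (k : ℝ) ^ 2) :=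
    (Real.summable_one_div_nat_pow.mpr one_lt_two).mul_left _
  have hfin : ∫⁻ ω, ∑' k, ENNReal.ofReal (f k ω) ∂μ ≠ ⊤ := by
    rw [lintegral_tsum fun k => (hint k).aestronglyMeasurable.aemeasurable.ennreal_ofReal]
    refine ne_top_of_le_ne_top hsum.tsum_ofReal_ne_top (ENNReal.tsum_le_tsum fun k => ?_)
    rw [← ofReal_integral_eq_lintegral_ofReal (hint k) (ae_of_all _ (hf0 k))]
    exact ENNReal.ofReal_le_ofReal (hfi k)
  have hae := ae_lt_top' (AEMeasurable.tsum fun k =>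
    (hint k).aestronglyMeasurable.aemeasurable.ennreal_ofReal) hfin
  filter_upwards [hae] with ω hω
  refine tendsto_average_of_squares (fun n => hB n _) ?_
  have h1 := ENNReal.tendsto_atTop_zero_of_tsum_ne_top hω.ne
  have h2 : Tendsto (fun k => f k ω) atTop (𝓝 0) := by
    have := (ENNReal.tendsto_toReal ENNReal.zero_ne_top).comp h1
    simpa [Function.comp_def, ENNReal.toReal_ofReal (hf0 _ ω)] using this
  have h3 := h2.sqrt
  rw [Real.sqrt_zero] at h3
  refine h3.congr fun k => ?_
  rw [hf]
  simp only
  rw [Complex.normSq_eq_norm_sq, show (k : ℝ) ^ 4 = ((k : ℝ) ^ 2) ^ 2 by ring, ← div_pow,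
    Real.sqrt_sq (by positivity)]

end Record

/-! ### The tomography process -/

section Scheme

variable {X K : Type*} [Fintype X] [Fintype K] (T : Scheme X K) (U : TwoQubit)

theorem Scheme.instrument_add (x : X) (k : K) (A B : Qubit) :
    T.instrument U x k (A + B) = T.instrument U x k A + T.instrument U x k B := by
  simp [Scheme.instrument, Matrix.add_kronecker, Matrix.mul_add, Matrix.add_mul, traceSystem_add]

theorem Scheme.instrument_smul (x : X) (k : K) (c : ℂ) (A : Qubit) :
    T.instrument U x k (c • A) = c • T.instrument U x k A := by
  simp [Scheme.instrument, Matrix.smul_kronecker, traceSystem_smul]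

/-- The weighted probability of setting `x` and outcome `k`, as a linear functional of the
memory operator. -/
noncomputable def Scheme.weight (x : X) (k : K) : Qubit →ₗ[ℂ] ℂ where
  toFun ξ := T.q x * (T.instrument U x k ξ).trace
  map_add' A B := by rw [T.instrument_add, Matrix.trace_add, mul_add]
  map_smul' c A := by
    rw [T.instrument_smul, Matrix.trace_smul, smul_eq_mul, mul_left_comm]; rfl

/-- The full trace may be taken through either factor. This turns statistics computed from the
memory instrument into statistics of the channel on the system. -/
theorem Scheme.weight_apply (x : X) (k : K) (ξ : Qubit) :
    T.weight U x k ξ = T.q x * (T.E k * systemChannel U ξ (T.ρ x)).trace := by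
  change _ * (traceSystem _).trace = _ * (_ * traceMemory _).trace
  rw [trace_traceSystem, ← trace_traceMemory, traceMemory_mul_system, Matrix.trace_mul_comm]

theorem Scheme.posSemidef_instrument (x : X) (k : K) {ξ : Qubit} (hξ : ξ.PosSemidef) :
    (T.instrument U x k ξ).PosSemidef :=
  posSemidef_traceSystem_mul ((hξ.kronecker (T.ρ_state x).1).mul_mul_conjTranspose_same U)
    (T.E_pos k)

theorem traceSystem_sum {ι : Type*} (s : Finset ι) (f : ι → TwoQubit) :
    traceSystem (∑ i ∈ s, f i) = ∑ i ∈ s, traceSystem (f i) :=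
  map_sum (AddMonoidHom.mk' traceSystem traceSystem_add) f s

theorem kronecker_sum {ι : Type*} (s : Finset ι) (A : Qubit) (f : ι → Qubit) :
    A ⊗ₖ (∑ i ∈ s, f i) = ∑ i ∈ s, A ⊗ₖ f i :=
  map_sum (AddMonoidHom.mk' (fun B : Qubit => A ⊗ₖ B) (Matrix.kronecker_add A)) f s

/-- Forgetting the outcome removes the effects, and forgetting the setting averages the inputs. This
is the source of every conditional mean below. -/
theorem Scheme.sum_instrument (ξ : Qubit) :
    ∑ a : X × K, (T.q a.1 : ℂ) • T.instrument U a.1 a.2 ξ = memoryChannel U T.average ξ := by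
  rw [Fintype.sum_prod_type]
  have h : ∀ x, ∑ k, T.instrument U x k ξ = traceSystem (U * (ξ ⊗ₖ T.ρ x) * U.conjTranspose) := by
    intro x
    simp only [Scheme.instrument]
    rw [← traceSystem_sum, ← Finset.mul_sum, ← kronecker_sum, T.E_sum, Matrix.one_kronecker_one,
      mul_one]
  simp only [← Finset.smul_sum, h, memoryChannel, Scheme.average, kronecker_sum, Finset.mul_sum,
    Finset.sum_mul, traceSystem_sum, Matrix.kronecker_smul, mul_smul_comm, smul_mul_assoc,
    traceSystem_smul]

theorem trace_memoryChannel {U : TwoQubit} (hU : U ∈ Matrix.unitaryGroup (Fin 2 × Fin 2) ℂ)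
    (ξ : Qubit) : (memoryChannel U mixed ξ).trace = ξ.trace := by
  have h : U.conjTranspose * U = 1 := Matrix.mem_unitaryGroup_iff'.mp hU
  rw [memoryChannel, trace_traceSystem, Matrix.trace_mul_cycle, h, one_mul, Matrix.trace_kronecker,
    mixed, Matrix.trace_smul, Matrix.trace_one]
  simp

theorem trace_systemChannel {U : TwoQubit} (hU : U ∈ Matrix.unitaryGroup (Fin 2 × Fin 2) ℂ)
    (ξ ρ : Qubit) : (systemChannel U ξ ρ).trace = ξ.trace * ρ.trace := by
  have h : U.conjTranspose * U = 1 := Matrix.mem_unitaryGroup_iff'.mp hU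
  change (traceMemory _).trace = _
  rw [trace_traceMemory, Matrix.trace_mul_cycle, h, one_mul, Matrix.trace_kronecker]

variable {ξ : Qubit}

theorem Scheme.posSemidef_branch (hξ : ξ.PosSemidef) (w : ℕ → X × K) (n : ℕ) :
    (T.branch U ξ w n).PosSemidef := by
  induction n with
  | zero => exact hξ
  | succ n ih =>
    exact (T.posSemidef_instrument U _ _ ih).smul
      (Complex.zero_le_real.mpr (T.q_pos (w n).1).le)

theorem Scheme.dependsOn_branch (n : ℕ) :
    DependsOn (fun w => T.branch U ξ w n) (Set.Iio n) := by
  induction n with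
  | zero => exact fun _ _ _ => rfl
  | succ n ih =>
    intro w w' hw
    have h1 : T.branch U ξ w n = T.branch U ξ w' n :=
      ih fun i hi => hw i (Set.Iio_subset_Iio n.le_succ hi)
    have h2 : w n = w' n := hw n (Set.mem_Iio.mpr n.lt_succ_self)
    simp only [Scheme.branch, h1, h2]

theorem Scheme.dependsOn_memoryState (n : ℕ) :
    DependsOn (fun w => T.memoryState U ξ w n) (Set.Iio n) := fun w w' hw => by
  have h : T.branch U ξ w n = T.branch U ξ w' n := T.dependsOn_branch U n hw
  simp only [Scheme.memoryState, h]

theorem Scheme.branch_update (w : ℕ → X × K) (n : ℕ) (a : X × K) :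
    T.branch U ξ (Function.update w n a) n = T.branch U ξ w n :=
  T.dependsOn_branch U n fun _ hi => Function.update_of_ne (Set.mem_Iio.mp hi).ne _ _

theorem Scheme.memoryState_update (w : ℕ → X × K) (n : ℕ) (a : X × K) :
    T.memoryState U ξ (Function.update w n a) n = T.memoryState U ξ w n := by
  simp only [Scheme.memoryState, T.branch_update]

theorem Scheme.branch_update_succ (w : ℕ → X × K) (n : ℕ) (a : X × K) :
    T.branch U ξ (Function.update w n a) (n + 1) =
      (T.q a.1 : ℂ) • T.instrument U a.1 a.2 (T.branch U ξ w n) := by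
  rw [Scheme.branch, T.branch_update, Function.update_self]

/-- The probability of the first `n` settings and outcomes. -/
noncomputable def Scheme.prefixProb (ξ : Qubit) (w : ℕ → X × K) (n : ℕ) : ℝ :=
  (T.branch U ξ w n).trace.re

theorem Scheme.ofReal_prefixProb (hξ : ξ.PosSemidef) (w : ℕ → X × K) (n : ℕ) :
    (T.prefixProb U ξ w n : ℂ) = (T.branch U ξ w n).trace :=
  (Complex.eq_re_of_ofReal_le (r := 0)
    (by simpa using (T.posSemidef_branch U hξ w n).trace_nonneg)).symm

theorem Scheme.prefixProb_nonneg (hξ : ξ.PosSemidef) (w : ℕ → X × K) (n : ℕ) :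
    0 ≤ T.prefixProb U ξ w n :=
  (Complex.nonneg_iff.mp (T.posSemidef_branch U hξ w n).trace_nonneg).1

theorem Scheme.IsRecord.hasPrefixLaw {T : Scheme X K} {U : TwoQubit} {Ω : Type*}
    [MeasurableSpace Ω] {μ : Measure Ω} {ev : ℕ → Ω → X × K} (hξ : ξ.PosSemidef)
    (h : T.IsRecord U ξ μ ev) : HasPrefixLaw μ ev (T.prefixProb U ξ) :=
  ⟨h.measurable, T.prefixProb_nonneg U hξ, h.law⟩

/-- No exception is needed at probability zero: a positive operator of trace zero vanishes, so the
default value 0 of the memory state is harmless. -/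
theorem Scheme.prefixProb_smul_memoryState (hξ : ξ.PosSemidef) (w : ℕ → X × K) (n : ℕ) :
    (T.prefixProb U ξ w n : ℂ) • T.memoryState U ξ w n = T.branch U ξ w n := by
  rw [T.ofReal_prefixProb U hξ, Scheme.memoryState, smul_smul]
  by_cases h : (T.branch U ξ w n).trace = 0
  · rw [((T.posSemidef_branch U hξ w n).trace_eq_zero_iff).mp h]; simp
  · rw [mul_inv_cancel₀ h, one_smul]

theorem Scheme.sum_branch_update (hT : T.average = mixed) (w : ℕ → X × K) (n : ℕ) :
    ∑ a, T.branch U ξ (Function.update w n a) (n + 1) =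
      memoryChannel U mixed (T.branch U ξ w n) := by
  simp_rw [T.branch_update_succ]
  rw [T.sum_instrument, hT]

theorem Scheme.sum_prefixProb_update (hT : T.average = mixed)
    (hU : U ∈ Matrix.unitaryGroup (Fin 2 × Fin 2) ℂ) (hξ : ξ.PosSemidef) (w : ℕ → X × K) (n : ℕ) :
    ∑ a, (T.prefixProb U ξ (Function.update w n a) (n + 1) : ℂ) = T.prefixProb U ξ w n := by
  simp_rw [T.ofReal_prefixProb U hξ]
  rw [← Matrix.trace_sum, T.sum_branch_update U hT, trace_memoryChannel hU]

/-! ### Boundedness -/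

/-- Diagonal entries are nonnegative with sum at most 1, and the determinant bounds the off-diagonal
ones. The trace is only required to be at most 1, to include the default memory state 0. -/
theorem norm_apply_le_one {A : Qubit} (hA : A.PosSemidef) (ht : A.trace.re ≤ 1) (i j : Fin 2) :
    ‖A i j‖ ≤ 1 := by
  have h0 := Complex.nonneg_iff.mp (hA.diag_nonneg (i := 0))
  have h1 := Complex.nonneg_iff.mp (hA.diag_nonneg (i := 1))
  have hd := (Complex.nonneg_iff.mp hA.det_nonneg).1
  have h10 : A 1 0 = star (A 0 1) := (hA.1.apply 1 0).symm
  rw [Matrix.trace, Fin.sum_univ_two] at ht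
  simp only [Matrix.diag_apply, Complex.add_re] at ht
  rw [Matrix.det_fin_two, h10, Complex.sub_re, Complex.mul_re, ← h0.2, ← h1.2,
    show A 0 1 * star (A 0 1) = _ from Complex.mul_conj _, Complex.ofReal_re,
    Complex.normSq_eq_norm_sq] at hd
  have e0 : ‖A 0 0‖ = (A 0 0).re := (Complex.re_eq_norm.mpr hA.diag_nonneg).symm
  have e1 : ‖A 1 1‖ = (A 1 1).re := (Complex.re_eq_norm.mpr hA.diag_nonneg).symm
  have h01 : ‖A 0 1‖ ≤ 1 := by
    rw [← sq_le_one_iff₀ (norm_nonneg _)]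
    nlinarith
  fin_cases i <;> fin_cases j
  · change ‖A 0 0‖ ≤ 1; linarith
  · exact h01
  · change ‖A 1 0‖ ≤ 1; rw [h10, norm_star]; exact h01
  · change ‖A 1 1‖ ≤ 1; linarith

theorem exists_bound (f : Qubit →ₗ[ℂ] ℂ) :
    ∃ B, ∀ A : Qubit, (∀ i j, ‖A i j‖ ≤ 1) → ‖f A‖ ≤ B := by
  refine ⟨∑ i, ∑ j, ‖f (Matrix.single i j 1)‖, fun A hA => ?_⟩
  have : f A = ∑ i, ∑ j, A i j * f (Matrix.single i j 1) := by
    conv_lhs => rw [Matrix.matrix_eq_sum_single A]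
    simp only [map_sum]
    refine Finset.sum_congr rfl fun i _ => Finset.sum_congr rfl fun j _ => ?_
    rw [← smul_eq_mul, ← map_smul, Matrix.smul_single, smul_eq_mul, mul_one]
  rw [this]
  refine norm_sum_le_of_le _ fun i _ => norm_sum_le_of_le _ fun j _ => ?_
  rw [norm_mul]
  exact mul_le_of_le_one_left (norm_nonneg _) (hA i j)

theorem Scheme.norm_memoryState_le (hξ : ξ.PosSemidef) (w : ℕ → X × K) (n : ℕ) (i j : Fin 2) :
    ‖T.memoryState U ξ w n i j‖ ≤ 1 := by
  have hb := T.posSemidef_branch U hξ w n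
  refine norm_apply_le_one (hb.smul ?_) ?_ i j
  · rw [← T.ofReal_prefixProb U hξ, ← Complex.ofReal_inv]
    exact Complex.zero_le_real.mpr (inv_nonneg.mpr (T.prefixProb_nonneg U hξ w n))
  · rw [Matrix.trace_smul, smul_eq_mul]
    by_cases h : (T.branch U ξ w n).trace = 0
    · simp [h]
    · simp [inv_mul_cancel₀ h]

theorem Scheme.trace_memoryState (w : ℕ → X × K) (n : ℕ)
    (h : T.prefixProb U ξ w n ≠ 0) : (T.memoryState U ξ w n).trace = 1 := by
  rw [Scheme.memoryState, Matrix.trace_smul, smul_eq_mul, inv_mul_cancel₀]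
  intro h0
  exact h (by rw [Scheme.prefixProb, h0, Complex.zero_re])

/-! ### Almost sure averages -/

variable {Ω : Type*} [MeasurableSpace Ω] {μ : Measure Ω} [IsProbabilityMeasure μ]
  {ev : ℕ → Ω → X × K} {T U}

theorem Scheme.nonempty (T : Scheme X K) : Nonempty (X × K) := by
  have hX : Nonempty X := by
    by_contra h
    rw [not_nonempty_iff] at h
    simpa using T.q_sum
  have hK : Nonempty K := by
    by_contra h
    rw [not_nonempty_iff] at h
    have := congrFun (congrFun T.E_sum 0) 0
    simp at this
  infer_instance

/-- Given the past, the mean of the next memory state is the memory channel applied to the present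
one, so each matrix entry of the difference is a bounded martingale difference. -/
theorem Scheme.IsRecord.ae_average_increment (hT : T.average = mixed)
    (hU : U ∈ Matrix.unitaryGroup (Fin 2 × Fin 2) ℂ) (hξ : ξ.PosSemidef)
    (h : T.IsRecord U ξ μ ev) (i j : Fin 2) :
    ∀ᵐ ω ∂μ, Tendsto (fun n : ℕ => (n : ℂ)⁻¹ * ∑ m ∈ Finset.range n,
      (T.memoryState U ξ (fun l => ev l ω) (m + 1) -
        memoryChannel U mixed (T.memoryState U ξ (fun l => ev l ω) m)) i j) atTop (𝓝 0) := by
  have := T.nonempty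
  obtain ⟨B, hB⟩ := exists_bound ((Matrix.entryLinearMap ℂ ℂ i j).comp (memoryMap U mixed))
  refine (h.hasPrefixLaw hξ).ae_tendsto_average (B := 1 + B)
    (d := fun m w => (T.memoryState U ξ w (m + 1) -
      memoryChannel U mixed (T.memoryState U ξ w m)) i j) ?_ ?_ ?_
  · intro n w w' hw
    have h1 : T.memoryState U ξ w (n + 1) = T.memoryState U ξ w' (n + 1) :=
      T.dependsOn_memoryState U _ hw
    have h2 : T.memoryState U ξ w n = T.memoryState U ξ w' n :=
      T.dependsOn_memoryState U _ fun i hi => hw i (Set.Iio_subset_Iio n.le_succ hi)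
    simp only [h1, h2]
  · intro n w
    exact (norm_sub_le _ _).trans (add_le_add (T.norm_memoryState_le U hξ w _ i j)
      (hB _ (T.norm_memoryState_le U hξ w n)))
  · intro n w
    have hM : ∑ a, (T.prefixProb U ξ (Function.update w n a) (n + 1) : ℂ) •
        (T.memoryState U ξ (Function.update w n a) (n + 1) -
          memoryChannel U mixed (T.memoryState U ξ (Function.update w n a) n)) = 0 := by
      simp only [smul_sub, T.prefixProb_smul_memoryState U hξ, T.memoryState_update,
        Finset.sum_sub_distrib, ← Finset.sum_smul]
      rw [T.sum_prefixProb_update U hT hU hξ, T.sum_branch_update U hT, ← memoryChannel_smul,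
        T.prefixProb_smul_memoryState U hξ, sub_self]
    have := congrFun (congrFun hM i) j
    simpa [Matrix.sum_apply] using this

-- The subtracted term is the conditional probability of the event given the earlier record; it is a
-- linear functional of the memory state, so its averages are its values at the mean memory state.
open Classical in
theorem Scheme.IsRecord.ae_average_event (hT : T.average = mixed)
    (hU : U ∈ Matrix.unitaryGroup (Fin 2 × Fin 2) ℂ) (hξ : ξ.PosSemidef)
    (h : T.IsRecord U ξ μ ev) (x : X) (k : K) :
    ∀ᵐ ω ∂μ, Tendsto (fun n : ℕ => (n : ℂ)⁻¹ * ∑ m ∈ Finset.range n,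
      ((if ev m ω = (x, k) then (1 : ℂ) else 0) -
        T.weight U x k (T.memoryState U ξ (fun l => ev l ω) m))) atTop (𝓝 0) := by
  have := T.nonempty
  obtain ⟨B, hB⟩ := exists_bound (T.weight U x k)
  refine (h.hasPrefixLaw hξ).ae_tendsto_average (B := 1 + B)
    (d := fun m w => (if w m = (x, k) then (1 : ℂ) else 0) -
        T.weight U x k (T.memoryState U ξ w m)) ?_ ?_ ?_
  · intro n w w' hw
    have h1 : w n = w' n := hw n (Set.mem_Iio.mpr n.lt_succ_self)
    have h2 : T.memoryState U ξ w n = T.memoryState U ξ w' n :=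
      T.dependsOn_memoryState U _ fun i hi => hw i (Set.Iio_subset_Iio n.le_succ hi)
    simp only [h1, h2]
  · intro n w
    refine (norm_sub_le _ _).trans (add_le_add ?_ (hB _ (T.norm_memoryState_le U hξ w n)))
    split_ifs <;> simp
  · intro n w
    simp only [mul_sub, Finset.sum_sub_distrib, T.memoryState_update, Function.update_self,
      ← Finset.sum_mul, mul_ite, mul_one, mul_zero, Finset.sum_ite_eq', Finset.mem_univ, if_true]
    rw [T.sum_prefixProb_update U hT hU hξ, ← smul_eq_mul, ← map_smul,
      T.prefixProb_smul_memoryState U hξ, T.ofReal_prefixProb U hξ, T.branch_update_succ,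
      Matrix.trace_smul]
    exact sub_self _

/-! ### Convergence to the complete mixture -/

/-- The completely mixed state is the only fixed point of trace one, provided that it is the
only fixed state. -/
theorem eq_zero_of_fixed {U : TwoQubit} (hU : U ∈ Matrix.unitaryGroup (Fin 2 × Fin 2) ℂ)
    (hu : HasUniqueFixedState (memoryChannel U mixed)) {A : Qubit}
    (hA : memoryChannel U mixed A = A) (ht : A.trace = 0) : A = 0 := by
  have key : ∀ H : Qubit, H.IsHermitian → H.trace = 0 → memoryChannel U mixed H = H → H = 0 := by
    intro H hH hHt hfix
    obtain ⟨r, rfl⟩ := exists_pauliVec hH hHt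
    have hsq : pauliVec r * pauliVec r = ((r ⬝ᵥ r : ℝ) : ℂ) • (1 : Qubit) := by
      ext a b
      fin_cases a <;> fin_cases b <;>
        simp [pauliVec_eq, dotProduct, Fin.sum_univ_three] <;> ring_nf <;> simp
    set c : ℝ := r ⬝ᵥ r with hc
    have hc0 : 0 ≤ c := by
      rw [hc, dotProduct]; exact Finset.sum_nonneg fun i _ => mul_self_nonneg _
    have hc1 : (1 + c : ℂ) ≠ 0 := by
      have : (1 + c : ℝ) ≠ 0 := by positivity
      exact_mod_cast this
    -- A square is positive for free, and (1 + r·σ)² = (1 + |r|²)·1 + 2 r·σ stays in the span of the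
    -- fixed points 1 and r·σ. Normalized, it is a fixed state that equals I/2 only if r·σ = 0.
    set S : Qubit := (1 + pauliVec r).conjTranspose * (1 + pauliVec r) with hS
    have hS' : S = (1 + c : ℂ) • (1 : Qubit) + (2 : ℂ) • pauliVec r := by
      rw [hS, Matrix.conjTranspose_add, isHermitian_pauliVec, Matrix.conjTranspose_one, add_mul,
        mul_add, mul_add, hsq, one_mul, one_mul, mul_one]
      module
    have hξ := hu.2 ((2 * (1 + c : ℂ))⁻¹ • S) ⟨?_, ?_⟩ ?_
    · rw [hS', smul_add, smul_smul, mixed, mul_inv, mul_assoc, inv_mul_cancel₀ hc1, mul_one,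
        one_div, add_eq_left, smul_smul] at hξ
      exact (smul_eq_zero.mp hξ).resolve_left (by simp [hc1])
    · refine (Matrix.posSemidef_conjTranspose_mul_self _).smul ?_
      have : (0 : ℝ) ≤ (2 * (1 + c))⁻¹ := by positivity
      exact_mod_cast Complex.zero_le_real.mpr this
    · rw [hS', Matrix.trace_smul, Matrix.trace_add, Matrix.trace_smul, Matrix.trace_smul,
        trace_pauliVec, Matrix.trace_one]
      simp only [Fintype.card_fin, Nat.cast_ofNat, smul_eq_mul, mul_zero, add_zero]
      field_simp
    · rw [memoryChannel_smul, hS', memoryChannel_add, memoryChannel_smul, memoryChannel_smul, hfix,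
        memoryChannel_mixed_one hU]
  -- The channel commutes with the adjoint, so the Hermitian and anti-Hermitian parts of A are fixed
  -- separately.
  have hAc : memoryChannel U mixed A.conjTranspose = A.conjTranspose := by
    rw [memoryChannel_conjTranspose, hA]
  have htc : A.conjTranspose.trace = 0 := by rw [Matrix.trace_conjTranspose, ht, star_zero]
  have h1 : A + A.conjTranspose = 0 := by
    refine key _ ?_ ?_ ?_
    · rw [Matrix.IsHermitian, Matrix.conjTranspose_add, Matrix.conjTranspose_conjTranspose,
        add_comm]
    · rw [Matrix.trace_add, ht, htc, add_zero]
    · rw [memoryChannel_add, hA, hAc]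
  have h2 : Complex.I • (A - A.conjTranspose) = 0 := by
    refine key _ ?_ ?_ ?_
    · rw [Matrix.IsHermitian, Matrix.conjTranspose_smul, Matrix.conjTranspose_sub,
        Matrix.conjTranspose_conjTranspose, Complex.star_def, Complex.conj_I, neg_smul, ← smul_neg,
        neg_sub]
    · rw [Matrix.trace_smul, Matrix.trace_sub, ht, htc, sub_zero, smul_zero]
    · rw [memoryChannel_smul, ← memoryMap_apply, map_sub, memoryMap_apply, memoryMap_apply, hA,
        hAc]
  have h3 := (smul_eq_zero.mp h2).resolve_left Complex.I_ne_zero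
  have h4 : (2 : ℂ) • A = 0 := by
    calc (2 : ℂ) • A = (A + A.conjTranspose) + (A - A.conjTranspose) := by module
      _ = 0 := by rw [h1, h3, add_zero]
  exact (smul_eq_zero.mp h4).resolve_left two_ne_zero

/-- Uniqueness makes A ↦ (A − C(A), Tr A) injective. In finite dimension it has a continuous linear
left inverse, so a small defect and the correct trace force closeness to I/2. The trace condition is
only eventual because the empty mean is 0. -/
theorem tendsto_mixed {U : TwoQubit} (hU : U ∈ Matrix.unitaryGroup (Fin 2 × Fin 2) ℂ)
    (hu : HasUniqueFixedState (memoryChannel U mixed)) {A : ℕ → Qubit}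
    (ht : ∀ᶠ n in atTop, (A n).trace = 1)
    (hA : Tendsto (fun n => A n - memoryChannel U mixed (A n)) atTop (𝓝 0)) :
    Tendsto A atTop (𝓝 mixed) := by
  let L : Qubit →ₗ[ℂ] Qubit × ℂ :=
    (LinearMap.id - memoryMap U mixed).prod (Matrix.traceLinearMap (Fin 2) ℂ ℂ)
  have hker : L.ker = ⊥ := by
    rw [LinearMap.ker_eq_bot']
    intro B hB
    have h1 : B - memoryChannel U mixed B = 0 := congrArg Prod.fst hB
    exact eq_zero_of_fixed hU hu (sub_eq_zero.mp h1).symm (congrArg Prod.snd hB)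
  obtain ⟨g, hg⟩ := L.exists_leftInverse_of_injective hker
  have hgc : Continuous g := g.continuous_of_finiteDimensional
  have hmt : mixed.trace = 1 := by rw [mixed, Matrix.trace_smul, Matrix.trace_one]; simp
  have hlim : Tendsto (fun n => L (A n - mixed)) atTop (𝓝 0) := by
    have h2 : Tendsto (fun n => (A n - memoryChannel U mixed (A n), (0 : ℂ))) atTop
        (𝓝 ((0 : Qubit), (0 : ℂ))) := hA.prodMk_nhds tendsto_const_nhds
    refine h2.congr' ?_
    filter_upwards [ht] with n hn
    refine Prod.ext ?_ ?_
    · change _ = (A n - mixed) - memoryMap U mixed (A n - mixed)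
      rw [map_sub, memoryMap_apply, memoryMap_apply, memoryChannel_mixed_mixed hU]
      exact (sub_sub_sub_cancel_right _ _ _).symm
    · change _ = (A n - mixed).trace
      rw [Matrix.trace_sub, hn, hmt, sub_self]
  have h3 := (hgc.tendsto 0).comp hlim
  have h4 : Tendsto (fun n => A n - mixed) atTop (𝓝 0) := by
    refine (map_zero g ▸ h3).congr fun n => ?_
    exact congrArg (fun f : Qubit →ₗ[ℂ] Qubit => f (A n - mixed)) hg
  simpa using h4.add_const mixed

/-- Replacing ξₘ by ξₘ₊₁ in the averaged defect telescopes, at the cost of a boundary term of order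
1/n; what remains is an average of martingale differences. -/
theorem meanMemoryState_eq (T : Scheme X K) (U : TwoQubit) (ξ : Qubit) (w : ℕ → X × K) (n : ℕ) :
    meanMemoryState T U ξ w n - memoryChannel U mixed (meanMemoryState T U ξ w n) =
      (n : ℂ)⁻¹ • ∑ m ∈ Finset.range n, (T.memoryState U ξ w (m + 1) -
        memoryChannel U mixed (T.memoryState U ξ w m)) -
      (n : ℂ)⁻¹ • (T.memoryState U ξ w n - T.memoryState U ξ w 0) := by
  rw [← Finset.sum_range_sub (fun m => T.memoryState U ξ w m), ← smul_sub,
    ← Finset.sum_sub_distrib, meanMemoryState, memoryChannel_smul, ← smul_sub,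
    ← memoryMap_apply, map_sum, ← Finset.sum_sub_distrib]
  congr 1
  refine Finset.sum_congr rfl fun m _ => ?_
  rw [memoryMap_apply]
  module

theorem Scheme.IsRecord.ae_tendsto_meanMemoryState (hT : T.average = mixed)
    (hU : U ∈ Matrix.unitaryGroup (Fin 2 × Fin 2) ℂ)
    (hu : HasUniqueFixedState (memoryChannel U mixed)) (hξ : ξ.PosSemidef)
    (h : T.IsRecord U ξ μ ev) :
    ∀ᵐ ω ∂μ, Tendsto (meanMemoryState T U ξ fun j => ev j ω) atTop (𝓝 mixed) := by
  have hne := T.nonempty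
  have h1 := ae_all_iff.mpr fun i => ae_all_iff.mpr fun j => h.ae_average_increment hT hU hξ i j
  have h2 := (h.hasPrefixLaw hξ).ae_ne_zero fun n w w' hw =>
    congrArg (fun B : Qubit => B.trace.re) (T.dependsOn_branch U n hw)
  filter_upwards [h1, h2] with ω h1 h2
  refine tendsto_mixed hU hu ?_ ?_
  · filter_upwards [eventually_ge_atTop 1] with n hn
    rw [meanMemoryState, Matrix.trace_smul, Matrix.trace_sum,
      Finset.sum_congr rfl fun m _ => T.trace_memoryState U _ m (h2 m)]
    have : (n : ℂ) ≠ 0 := by exact_mod_cast (by omega : n ≠ 0)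
    simp [this]
  · simp_rw [meanMemoryState_eq]
    rw [← sub_zero (0 : Qubit)]
    refine Tendsto.sub ?_ ?_
    · refine tendsto_pi_nhds.mpr fun i => tendsto_pi_nhds.mpr fun j => ?_
      refine (h1 i j).congr fun n => ?_
      rw [Matrix.smul_apply, Matrix.sum_apply, smul_eq_mul]
    · refine tendsto_pi_nhds.mpr fun i => tendsto_pi_nhds.mpr fun j => ?_
      have hb := (tendsto_inv_atTop_nhds_zero_nat (𝕜 := ℝ)).mul_const 2
      rw [zero_mul] at hb
      refine squeeze_zero_norm (fun n => ?_) hb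
      rw [Matrix.smul_apply, Matrix.sub_apply, smul_eq_mul, norm_mul, norm_inv,
        Complex.norm_natCast]
      refine mul_le_mul_of_nonneg_left ((norm_sub_le _ _).trans ?_) (by positivity)
      linarith [T.norm_memoryState_le U hξ (fun j => ev j ω) n i j,
        T.norm_memoryState_le U hξ (fun j => ev j ω) 0 i j]

open Classical in
theorem settingCount_eq_sum {X K : Type*} [Fintype K] (w : ℕ → X × K) (x : X) (n : ℕ) :
    settingCount w x n = ∑ k, eventCount w x k n := by
  simp only [settingCount, eventCount, Finset.card_filter]
  rw [Finset.sum_comm]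
  refine Finset.sum_congr rfl fun m _ => ?_
  simp only [Prod.ext_iff]
  by_cases h : (w m).1 = x <;> simp [h]

theorem Scheme.IsRecord.ae_reconstructs (hT : T.average = mixed)
    (hU : U ∈ Matrix.unitaryGroup (Fin 2 × Fin 2) ℂ)
    (hu : HasUniqueFixedState (memoryChannel U mixed)) (hξ : ξ.PosSemidef)
    (h : T.IsRecord U ξ μ ev) :
    ∀ᵐ ω ∂μ, Reconstructs T (fun j => ev j ω) (systemChannel U mixed) := by
  classical
  have h1 := ae_all_iff.mpr fun x => ae_all_iff.mpr fun k => h.ae_average_event hT hU hξ x k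
  filter_upwards [h1, h.ae_tendsto_meanMemoryState hT hU hu hξ] with ω h1 h2
  set w : ℕ → X × K := fun j => ev j ω with hw
  have hmt : mixed.trace = 1 := by rw [mixed, Matrix.trace_smul, Matrix.trace_one]; simp
  have hev : ∀ x k, Tendsto (fun n : ℕ => (n : ℂ)⁻¹ * (eventCount w x k n : ℂ)) atTop
      (𝓝 (T.weight U x k mixed)) := fun x k => by
    have hc : Continuous (T.weight U x k) := (T.weight U x k).continuous_of_finiteDimensional
    have h3 := (h1 x k).add ((hc.tendsto mixed).comp h2)
    rw [zero_add] at h3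
    refine h3.congr fun n => ?_
    simp only [Function.comp, meanMemoryState, map_smul, map_sum, smul_eq_mul,
      Finset.sum_sub_distrib, mul_sub, sub_add_cancel]
    rw [eventCount, Finset.card_filter]
    push_cast
    rfl
  have hset : ∀ x, Tendsto (fun n : ℕ => (n : ℂ)⁻¹ * (settingCount w x n : ℂ)) atTop
      (𝓝 (T.q x)) := fun x => by
    have h3 := tendsto_finsetSum Finset.univ fun k _ => hev x k
    -- Setting frequencies come from summing event frequencies over outcomes, so they need no
    -- separate law of large numbers. The limit q_x is positive, which permits the quotient.
    have h4 : ∑ k, T.weight U x k mixed = T.q x := by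
      simp_rw [T.weight_apply]
      rw [← Finset.mul_sum, ← Matrix.trace_sum, ← Finset.sum_mul, T.E_sum, one_mul,
        trace_systemChannel hU, hmt, (T.ρ_state x).2, mul_one, mul_one]
    rw [h4] at h3
    refine h3.congr fun n => ?_
    rw [settingCount_eq_sum, ← Finset.mul_sum]
    push_cast
    rfl
  intro x k
  have hq : (T.q x : ℂ) ≠ 0 := by exact_mod_cast (T.q_pos x).ne'
  have h3 := (hev x k).div (hset x) hq
  rw [T.weight_apply, mul_div_cancel_left₀ _ hq] at h3
  refine h3.congr' ?_
  filter_upwards [eventually_ge_atTop 1] with n hn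
  have : (n : ℂ) ≠ 0 := by exact_mod_cast (by omega : n ≠ 0)
  exact mul_div_mul_left _ _ (inv_ne_zero this)

/-- Complete tomography determines the reconstructed map. -/
theorem Reconstructs.unique {w : ℕ → X × K} {Φ Ψ : Qubit →ₗ[ℂ] Qubit}
    (hΦ : Reconstructs T w Φ) (hΨ : Reconstructs T w Ψ) : Φ = Ψ := by
  refine LinearMap.ext_on_range T.ρ_complete fun x => ?_
  have h1 : ∀ M : Qubit, (M * (Φ (T.ρ x) - Ψ (T.ρ x))).trace = 0 := by
    intro M
    have hM : M ∈ Submodule.span ℂ (Set.range T.E) := by rw [T.E_complete]; trivial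
    induction hM using Submodule.span_induction with
    | mem M hM =>
      obtain ⟨k, rfl⟩ := hM
      rw [mul_sub, Matrix.trace_sub, tendsto_nhds_unique (hΦ x k) (hΨ x k), sub_self]
    | zero => simp
    | add M N _ _ hM hN => rw [add_mul, Matrix.trace_add, hM, hN, add_zero]
    | smul c M _ hM => rw [smul_mul_assoc, Matrix.trace_smul, hM, smul_zero]
  -- Take M to be the adjoint of the difference itself: the trace is then its squared
  -- Hilbert–Schmidt norm.
  exact sub_eq_zero.mp (Matrix.trace_conjTranspose_mul_self_eq_zero_iff.mp (h1 _))

end Scheme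

end MemoryQPT

theorem mainTheorem4 {X K : Type*} [Fintype X] [Fintype K]
    (T : MemoryQPT.Scheme X K) (hT : T.average = MemoryQPT.mixed)
    (U : TwoQubit) (hU : U ∈ Matrix.unitaryGroup (Fin 2 × Fin 2) ℂ) :
    -- the memory channel is unital
    MemoryQPT.memoryChannel U T.average 1 = 1 ∧
    -- either a unique fixed point, or a controlled unitary, and not both
    Xor (MemoryQPT.HasUniqueFixedState (MemoryQPT.memoryChannel U T.average))
      (MemoryQPT.IsControlledUnitary U) ∧
    ∀ (α : Fin 3 → ℝ) (W₁ W₂ V₁ V₂ : Qubit),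
      MemoryQPT.IsCanonicalForm U α W₁ W₂ V₁ V₂ →
      -- without uniqueness: the parameters, and the form of the controlled unitary
      (¬ MemoryQPT.HasUniqueFixedState (MemoryQPT.memoryChannel U T.average) →
        α 1 = 0 ∧ α 2 = 0 ∧
        ∃ (b : OrthonormalBasis (Fin 2) ℂ (EuclideanSpace ℂ (Fin 2))) (c : Fin 2 → ℂ),
          (∀ l, ‖c l‖ = 1) ∧
          U = c 0 • (MemoryQPT.ketBra (b 0) ⊗ₖ
                (V₂ * NormedSpace.exp ((Complex.I * (α 0 / 2 : ℝ)) • MemoryQPT.pauli 0) * V₁)) +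
              c 1 • (MemoryQPT.ketBra (b 1) ⊗ₖ
                (V₂ * NormedSpace.exp ((-Complex.I * (α 0 / 2 : ℝ)) • MemoryQPT.pauli 0) * V₁))) ∧
      -- with uniqueness: the average memory state, the reconstructed channel and its Bloch form
      (MemoryQPT.HasUniqueFixedState (MemoryQPT.memoryChannel U T.average) →
        (∀ (Ω : Type*) [MeasurableSpace Ω] (μ : MeasureTheory.Measure Ω)
          [MeasureTheory.IsProbabilityMeasure μ] (ξ : Qubit) (ev : ℕ → Ω → X × K),
          MemoryQPT.IsState ξ → T.IsRecord U ξ μ ev →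
          ∀ᵐ ω ∂μ,
            Filter.Tendsto (MemoryQPT.meanMemoryState T U ξ (fun j => ev j ω)) Filter.atTop
              (nhds MemoryQPT.mixed) ∧
            ∀ Φ : Qubit →ₗ[ℂ] Qubit, MemoryQPT.Reconstructs T (fun j => ev j ω) Φ ↔
              Φ = MemoryQPT.systemChannel U MemoryQPT.mixed) ∧
        ∃ R₁ R₂ : Matrix (Fin 3) (Fin 3) ℝ,
          R₁ ∈ Matrix.specialOrthogonalGroup (Fin 3) ℝ ∧
          R₂ ∈ Matrix.specialOrthogonalGroup (Fin 3) ℝ ∧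
          MemoryQPT.IsBlochRotation V₁ R₁ ∧ MemoryQPT.IsBlochRotation V₂ R₂ ∧
          ∀ r : Fin 3 → ℝ,
            MemoryQPT.systemChannel U MemoryQPT.mixed (MemoryQPT.bloch r) =
              MemoryQPT.bloch ((R₂ * Matrix.diagonal
                ![Real.cos (α 1) * Real.cos (α 2), Real.cos (α 0) * Real.cos (α 2),
                  Real.cos (α 0) * Real.cos (α 1)] * R₁).mulVec r)) := by
  rw [hT]
  refine ⟨MemoryQPT.memoryChannel_mixed_one hU, ?_, fun α W₁ W₂ V₁ V₂ h =>
    ⟨fun hn => h.of_not_unique hU hn, fun hu => ⟨?_, ?_⟩⟩⟩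
  · by_cases hu : MemoryQPT.HasUniqueFixedState (MemoryQPT.memoryChannel U MemoryQPT.mixed)
    · exact Or.inl ⟨hu, fun hc =>
        MemoryQPT.not_hasUniqueFixedState_of_isControlledUnitary hU hc hu⟩
    · exact Or.inr ⟨MemoryQPT.isControlledUnitary_of_not_unique hU hu, hu⟩
  · intro Ω _ μ _ ξ ev hξ hrec
    filter_upwards [hrec.ae_tendsto_meanMemoryState hT hU hu hξ.1,
      hrec.ae_reconstructs hT hU hu hξ.1] with ω h1 h2
    -- Uniqueness is a pathwise statement about limits, so one null set serves all maps Φ at once.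
    exact ⟨h1, fun Φ => ⟨fun hΦ => hΦ.unique h2, fun hΦ => hΦ ▸ h2⟩⟩
  · obtain ⟨R₁, hR₁, h₁⟩ := MemoryQPT.exists_isBlochRotation h.system_in
    obtain ⟨R₂, hR₂, h₂⟩ := MemoryQPT.exists_isBlochRotation h.system_out
    exact ⟨R₁, R₂, hR₁, hR₂, h₁, h₂, h.systemChannel_bloch h₁ h₂⟩
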